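/- Let $M$ be an $n$-dimensional smooth manifold and $\mathcal T M=TM\setminus\{0\}$. Let $S$ be the geodesic spray of a Finsler function $F$ on $M$ (that is, $F\colon TM\to\mathbb R$ is continuous, smooth and positive on $\mathcal TM$, zero exactly on the zero section, positively $1$-homogeneous in $y$, with nondegenerate $g_{ij}=\frac12\partial^2F^2/\partial y^i\partial y^j$ on $\mathcal TM$). Let $J=\frac{\partial}{\partial y^i}\otimes dx^i$ and $\mathcal C=y^i\frac{\partial}{\partial y^i}$. A spray induces the horizontal projector $h=\frac12(\mathrm{Id}+[J,S])$, the curvature $R=\frac12[h,h]$ and the Jacobi endomorphism $\Phi=i_SR$. At $(x,y)\in\mathcal TM$ let $\kappa_1,\dots,\kappa_n$ be the eigenvalues of $\Phi$, i.e. $\Phi(X_\alpha)=\kappa_\alpha JX_\alpha$ for horizontal $X_\alpha\ne0$; here $\kappa_n=0$ belongs to $X_n=S$, and $\kappa_1,\dots,\kappa_{n-1}$ are the principal curvatures. The holonomy distribution $\mathcal Hol_S$ of a spray $S$ is the distribution on $\mathcal TM$ spanned by the smooth horizontal vector fields and their successive Lie brackets. Let $\mathcal P\colon TM\to\mathbb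 R$ be smooth on $\mathcal TM$, positively $1$-homogeneous in $y$, and holonomy invariant, i.e. invariant under the parallel translation of $S$. Let $\lambda\in\mathbb R$ and let $(x,y)\in\mathcal TM$ be a point such that $$\kappa_\alpha(x,y)+\lambda^2\mathcal P(x,y)^2\neq0\qquad\text{for all }\alpha=1,\dots,n,$$ and such that $\mathcal P$ is nonlinear at $(x,y)$, i.e. $\frac{\partial^2\mathcal P}{\partial y^i\partial y^j}(x,y)\ne0$ for some $i,j$. Then the holonomy distribution of the spray $\widetilde S=S-2\lambda\mathcal P\,\mathcal C$ is full at $(x,y)$: $$\mathcal Hol_{\widetilde S}\big|_{(x,y)}=T_{(x,y)}(TM).$$ In particular, $\mathcal Hol_{\widetilde S}=T(TM)$ on every open set $U\subset\mathcal TM$ at all of whose points these two conditions hold. -/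

import Mathlib

open scoped Manifold ContDiff Topology

/-! Sprays on an `n`-dimensional smooth manifold `M` (modelled on Euclidean space, without
boundary), their induced nonlinear connections, and holonomy distributions.  Tensors on the
tangent bundle are written through their action on local smooth vector fields. -/

namespace FinslerSpray

noncomputable section

/-- Model fibre: tangent spaces of an `n`-manifold are copies of it. -/
abbrev Fibre (n : ℕ) : Type := EuclideanSpace ℝ (Fin n)

/-- The model with corners of the total space `TM`. -/
abbrev modelTM (n : ℕ) : ModelWithCorners ℝ (Fibre n × Fibre n) (ModelProd (Fibre n) (Fibre n)) :=
  (𝓡 n).tangent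

section

variable {n : ℕ} {M : Type*} [TopologicalSpace M] [ChartedSpace (Fibre n) M]
  [IsManifold (𝓡 n) ∞ M]

/-- The slit tangent bundle: the set of nonzero tangent vectors. -/
def slit (n : ℕ) (M : Type*) [TopologicalSpace M] [ChartedSpace (Fibre n) M]
    [IsManifold (𝓡 n) ∞ M] : Set (TangentBundle (𝓡 n) M) :=
  {z | z.2 ≠ 0}

/-- (Not necessarily smooth) vector fields on `TM`. -/
abbrev Field (n : ℕ) (M : Type*) [TopologicalSpace M] [ChartedSpace (Fibre n) M]
    [IsManifold (𝓡 n) ∞ M] : Type _ :=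
  (z : TangentBundle (𝓡 n) M) → TangentSpace (modelTM n) z

/-- Smoothness of a vector field on a set `W ⊆ TM`. -/
def SmoothOn (X : Field n M) (W : Set (TangentBundle (𝓡 n) M)) : Prop :=
  ContMDiffOn (modelTM n) (modelTM n).tangent ∞
    (fun z => (⟨z, X z⟩ : TangentBundle (modelTM n) (TangentBundle (𝓡 n) M))) W

/-- The Lie bracket of vector fields on `TM`. -/
def bracket (X Y : Field n M) : Field n M :=
  VectorField.mlieBracket (modelTM n) X Y

/-- The derivative `X f` of a function `f` on `TM` along a vector field `X`. -/
def dirDeriv (X : Field n M) (f : TangentBundle (𝓡 n) M → ℝ) : TangentBundle (𝓡 n) M → ℝ :=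
  fun z => mfderiv (modelTM n) 𝓘(ℝ, ℝ) f z (X z)

/-- The vertical lift to `z = (x, y)` of a tangent vector `w ∈ T_x M`: the derivative at `y`, in
the direction `w`, of the inclusion of the fibre `T_x M` into `TM`. -/
def verticalLift (z : TangentBundle (𝓡 n) M) (w : TangentSpace (𝓡 n) z.1) :
    TangentSpace (modelTM n) z :=
  mfderiv 𝓘(ℝ, Fibre n) (modelTM n)
    (fun y : Fibre n => (⟨z.1, y⟩ : TangentBundle (𝓡 n) M)) z.2 w

/-- The natural almost-tangent structure `J = ∂/∂yⁱ ⊗ dxⁱ`: project to `TM`, then lift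
vertically. -/
def J (X : Field n M) : Field n M := fun z =>
  verticalLift z
    (mfderiv (modelTM n) (𝓡 n) (fun p : TangentBundle (𝓡 n) M => p.1) z (X z))

/-- The Liouville vector field `𝒞 = yⁱ ∂/∂yⁱ`. -/
def liouville : Field n M := fun z => verticalLift z z.2

/-- Sprays: smooth vector fields `S` on the slit tangent bundle with `J S = 𝒞`, `[𝒞, S] = S`. -/
structure IsSpray (S : Field n M) : Prop where
  smooth : SmoothOn S (slit n M)
  J_eq : ∀ z ∈ slit n M, J S z = liouville z
  homogeneous : ∀ z ∈ slit n M, bracket liouville S z = S z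

/-- The nonlinear connection `Γ = [J, S]` (Frölicher–Nijenhuis bracket), acting on fields. -/
def connection (S X : Field n M) : Field n M := fun z =>
  bracket (J X) S z - J (bracket X S) z

/-- The horizontal projector `h = (Id + Γ) / 2`. -/
def hor (S X : Field n M) : Field n M := fun z => (1 / 2 : ℝ) • (X z + connection S X z)

/-- `X` is a smooth horizontal vector field on `W`. -/
def IsHorizontalField (S X : Field n M) (W : Set (TangentBundle (𝓡 n) M)) : Prop :=
  SmoothOn X W ∧ ∀ z ∈ W, hor S X z = X z

/-- `ξ ∈ T_z(TM)` belongs to the horizontal space at `z`: it is the value of a smooth horizontal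
field defined near `z`. -/
def IsHorizontalVector (S : Field n M) (z : TangentBundle (𝓡 n) M)
    (ξ : TangentSpace (modelTM n) z) : Prop :=
  ∃ (W : Set (TangentBundle (𝓡 n) M)) (X : Field n M),
    IsOpen W ∧ z ∈ W ∧ W ⊆ slit n M ∧ IsHorizontalField S X W ∧ X z = ξ

/-- The curvature `R = ½ [h, h]`, the Nijenhuis torsion of `h`, evaluated on two fields. -/
def curvature (S X Y : Field n M) : Field n M := fun z =>
  bracket (hor S X) (hor S Y) z + hor S (hor S (bracket X Y)) z
    - hor S (bracket (hor S X) Y) z - hor S (bracket X (hor S Y)) z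

/-- The Jacobi endomorphism (Riemann curvature) `Φ = i_S R`. -/
def jacobi (S X : Field n M) : Field n M := curvature S S X

/-- `κ` is an eigenvalue of the Jacobi endomorphism at `z`: `Φ X = κ • J X` at `z` for some
horizontal `X` not vanishing at `z`. These numbers are `κ₁(z), …, κₙ(z)`: the principal
curvatures at `z`, together with the eigenvalue `κₙ = 0` belonging to the eigenvector `S`. -/
def IsJacobiEigenvalue (S : Field n M) (z : TangentBundle (𝓡 n) M) (κ : ℝ) : Prop :=
  ∃ (W : Set (TangentBundle (𝓡 n) M)) (X : Field n M),
    IsOpen W ∧ z ∈ W ∧ W ⊆ slit n M ∧ IsHorizontalField S X W ∧ X z ≠ 0 ∧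
      jacobi S X z = κ • J X z

/-- The iterated brackets `[X₁, [X₂, … [X_{m-1}, X_m] … ]]`, `m ≥ 1`, of smooth horizontal vector
fields on `W`. -/
inductive IsIteratedBracket (S : Field n M) (W : Set (TangentBundle (𝓡 n) M)) :
    Field n M → Prop
  | base (X : Field n M) : IsHorizontalField S X W → IsIteratedBracket S W X
  | step (X Y : Field n M) : IsHorizontalField S X W → IsIteratedBracket S W Y →
      IsIteratedBracket S W (bracket X Y)

/-- The holonomy distribution of `S` at `z`: the subspace of `T_z(TM)` spanned by the values at
`z` of the iterated Lie brackets of smooth horizontal vector fields defined near `z`. -/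
def holonomyDistribution (S : Field n M) (z : TangentBundle (𝓡 n) M) :
    Submodule ℝ (TangentSpace (modelTM n) z) :=
  Submodule.span ℝ {ξ | ∃ (W : Set (TangentBundle (𝓡 n) M)) (X : Field n M),
    IsOpen W ∧ z ∈ W ∧ W ⊆ slit n M ∧ IsIteratedBracket S W X ∧ X z = ξ}

/-- `γ` is a parallel field of nonzero vectors along its projection to `M` for times in
`[a, b]`, i.e. its velocity is horizontal. So parallel translation along the projected curve
carries `γ a` to `γ b`. -/
def IsParallelOn (S : Field n M) (γ : ℝ → TangentBundle (𝓡 n) M) (a b : ℝ) : Prop :=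
  ∀ t ∈ Set.Icc a b, γ t ∈ slit n M ∧ MDifferentiableAt 𝓘(ℝ, ℝ) (modelTM n) γ t ∧
    IsHorizontalVector S (γ t) (mfderiv 𝓘(ℝ, ℝ) (modelTM n) γ t (1 : ℝ))

/-- `P` is holonomy invariant: it is invariant under parallel translation. -/
def IsHolonomyInvariant (S : Field n M) (P : TangentBundle (𝓡 n) M → ℝ) : Prop :=
  ∀ (γ : ℝ → TangentBundle (𝓡 n) M) (a b : ℝ), a ≤ b → IsParallelOn S γ a b →
    P (γ b) = P (γ a)

/-- Positive homogeneity of degree `1` in the fibre variable, on nonzero vectors. -/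
def IsOneHomogeneous (f : TangentBundle (𝓡 n) M → ℝ) : Prop :=
  ∀ z ∈ slit n M, ∀ t : ℝ, 0 < t → f ⟨z.1, t • z.2⟩ = t * f z

/-- The second derivative `∂²f / ∂yⁱ∂yʲ` along the fibre through `z = (x, y)`. -/
def fibreHessian (f : TangentBundle (𝓡 n) M → ℝ) (z : TangentBundle (𝓡 n) M) :
    Fibre n →L[ℝ] Fibre n →L[ℝ] ℝ :=
  fderiv ℝ (fderiv ℝ (fun y : Fibre n => f ⟨z.1, y⟩)) z.2

/-- `f` is nonlinear in `y` at `z`: some `∂²f / ∂yⁱ∂yʲ` is nonzero at `z`. -/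
def IsNonlinearAt (f : TangentBundle (𝓡 n) M → ℝ) (z : TangentBundle (𝓡 n) M) : Prop :=
  fibreHessian f z ≠ 0

/-- Finsler functions. -/
structure IsFinslerFunction (F : TangentBundle (𝓡 n) M → ℝ) : Prop where
  continuous : Continuous F
  smooth : ContMDiffOn (modelTM n) 𝓘(ℝ, ℝ) ∞ F (slit n M)
  pos : ∀ z ∈ slit n M, 0 < F z
  zero : ∀ z : TangentBundle (𝓡 n) M, z.2 = 0 → F z = 0
  homogeneous : IsOneHomogeneous F
  nondegenerate : ∀ z ∈ slit n M, ∀ u : Fibre n,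
    (∀ w, fibreHessian (fun p => (1 / 2 : ℝ) * F p ^ 2) z u w = 0) → u = 0

/-- `S` is the geodesic spray of `F`: it satisfies the Euler–Lagrange equation
`i_S dd_J E = -dE`, `E = F² / 2`, which is evaluated here on smooth local fields `X`, with
`dω(S, X) = S(ω X) - X(ω S) - ω [S, X]` for `ω = d_J E = dE ∘ J`. -/
def IsGeodesicSpray (F : TangentBundle (𝓡 n) M → ℝ) (S : Field n M) : Prop :=
  IsSpray S ∧
    ∀ (W : Set (TangentBundle (𝓡 n) M)) (X : Field n M), IsOpen W → W ⊆ slit n M →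
      SmoothOn X W → ∀ z ∈ W,
        let E : TangentBundle (𝓡 n) M → ℝ := fun p => (1 / 2 : ℝ) * F p ^ 2
        dirDeriv S (dirDeriv (J X) E) z - dirDeriv X (dirDeriv (J S) E) z
            - dirDeriv (J (bracket S X)) E z
          = - dirDeriv X E z

/-- Finsler metrizable sprays: geodesic sprays of Finsler functions. -/
def IsFinslerMetrizable (S : Field n M) : Prop :=
  ∃ F : TangentBundle (𝓡 n) M → ℝ, IsFinslerFunction F ∧ IsGeodesicSpray F S

/-- The projective deformation `S - 2 Q 𝒞` with projective factor `Q`. -/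
def projectiveDeformation (S : Field n M) (Q : TangentBundle (𝓡 n) M → ℝ) : Field n M :=
  fun z => S z - (2 * Q z) • liouville z

end

end

end FinslerSpray

/-! In a chart of `TM` the spray is `(y, -2G)` and the horizontal space is spanned by `δ_u = (u, -N
u)` with `N = ∂G/∂y`. Write `p` for `𝒫` in coordinates, `p_u` for its derivative along the vertical
vector `(0, u)`, and `c = λ`. The deformation replaces `G` by `G + c p y`. Everything rests on
homogeneity (`p_y = p`, hence `p_{yw} = 0`) and on holonomy invariance, which infinitesimally says
`δ_u p = 0`.

The new lifts `δ'_u` satisfy `δ'_u p = -2 c p p_u`, and the new curvature is `[δ'_u, δ'_v] = [δ_u,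
δ_v] + c² p (0, p_u v - p_v u)` (`lieBracket_deform`). Both summands are annihilated by `dp`, so the
first brackets produce only vertical vectors in `ker dp`. They produce all of them: for `u = y` and
`p_v = 0` the bracket is `Φ v + c² p² v`, and `Φ + c² p²` is invertible because no eigenvalue `κ` of
`Φ` equals `-c² p²` (`exists_lieBracket_eq_vertical`).

One vertical direction is still missing. For a first bracket `Y`, `dp([δ'_w, Y]) = 2 c p · p_{Yw}`
(`fderiv_lieBracket_lieBracket_deform`). Here `c p ≠ 0`, since `κ = 0` is an eigenvalue. Since
`p_{yw} = 0`, nonlinearity of `p` is already visible on `ker dp`, so some second bracket is vertical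
and transverse to the level sets of `p`. With the lifts themselves this fills the tangent space
(`eq_top_of_mem`).

The rest translates the invariant definitions into this picture: `hat_hor` for the projector,
`IsSpray.hat_jacobi` for `Φ`, `IsHolonomyInvariant.fderiv_horLift` for parallel translation, and
`holonomyDistribution_eq_top` for the conclusion. -/

namespace FinslerSpray

noncomputable section

/-! ### Sprays and invariant functions on an open subset of `E × E`: the brackets in coordinates. -/

namespace Coord

open VectorField

variable {E : Type*} [NormedAddCommGroup E] [NormedSpace ℝ E]

/-- The coefficients `N = ∂G / ∂y` of the nonlinear connection of the spray `(y, -2 G)`. -/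
def nonlin (G : E × E → E) (q : E × E) : E →L[ℝ] E :=
  (fderiv ℝ G q).comp (ContinuousLinearMap.inr ℝ E E)

/-- The horizontal lift of the constant vector `u`. -/
def horLift (G : E × E → E) (u : E) : E × E → E × E := fun q => (u, -nonlin G q u)

/-- The coefficients of the spray `(y, -2 G)` deformed by the projective factor `c p`. -/
def deform (c : ℝ) (p : E × E → ℝ) (G : E × E → E) : E × E → E :=
  fun q => G q + (c * p q) • q.2

/-- The coordinate form of the data of the theorem on an open set. -/
structure Invariant (G : E × E → E) (p : E × E → ℝ) (Ω : Set (E × E)) : Prop where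
  isOpen : IsOpen Ω
  smoothG : ContDiffOn ℝ ∞ G Ω
  smooth : ContDiffOn ℝ ∞ p Ω
  homG : ∀ q ∈ Ω, fderiv ℝ G q (0, q.2) = (2 : ℝ) • G q
  hom : ∀ q ∈ Ω, fderiv ℝ p q (0, q.2) = p q
  invariant : ∀ u, ∀ q ∈ Ω, fderiv ℝ p q (horLift G u q) = 0

lemma nonlin_apply (G : E × E → E) (q : E × E) (u : E) :
    nonlin G q u = fderiv ℝ G q (0, u) := rfl

lemma minSmoothness_two_le : minSmoothness ℝ 2 ≤ (∞ : ℕ∞ω) := by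
  rw [minSmoothness_of_isRCLikeNormedField]
  exact WithTop.coe_le_coe.2 le_top

section Smooth

variable {F : Type*} [NormedAddCommGroup F] [NormedSpace ℝ F] {f : E × E → F} {G : E × E → E}
  {Ω : Set (E × E)} {q : E × E}

lemma contDiffAt_fderiv (hf : ContDiffAt ℝ ∞ f q) : ContDiffAt ℝ ∞ (fderiv ℝ f) q :=
  hf.fderiv_right (by simp)

lemma contDiffAt_horLift (hG : ContDiffAt ℝ ∞ G q) (u : E) : ContDiffAt ℝ ∞ (horLift G u) q :=
  contDiffAt_const.prodMk (((contDiffAt_fderiv hG).clm_apply contDiffAt_const).neg)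

lemma contDiffAt_deform {p : E × E → ℝ} (c : ℝ) (hG : ContDiffAt ℝ ∞ G q)
    (hp : ContDiffAt ℝ ∞ p q) : ContDiffAt ℝ ∞ (deform c p G) q :=
  hG.add ((contDiffAt_const.mul hp).smul contDiffAt_snd)

lemma fderiv_fderiv_comm (hf : ContDiffAt ℝ ∞ f q) (ξ η : E × E) :
    fderiv ℝ (fderiv ℝ f) q ξ η = fderiv ℝ (fderiv ℝ f) q η ξ :=
  (hf.isSymmSndFDerivAt minSmoothness_two_le).eq ξ η

lemma fderiv_fderiv_apply_const (hf : ContDiffAt ℝ ∞ f q) (v ξ : E × E) :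
    fderiv ℝ (fun r => fderiv ℝ f r v) q ξ = fderiv ℝ (fderiv ℝ f) q ξ v := by
  rw [fderiv_clm_apply ((contDiffAt_fderiv hf).differentiableAt (by simp))
    (differentiableAt_const _)]
  simp

lemma fderiv_horLift_apply (hG : ContDiffAt ℝ ∞ G q) (u : E) (ξ : E × E) :
    fderiv ℝ (horLift G u) q ξ = (0, -fderiv ℝ (fderiv ℝ G) q ξ (0, u)) := by
  have h : DifferentiableAt ℝ (fun r => fderiv ℝ G r (0, u)) q :=
    ((contDiffAt_fderiv hG).differentiableAt (by simp)).clm_apply (differentiableAt_const _)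
  have h2 : HasFDerivAt (horLift G u)
      ((0 : E × E →L[ℝ] E).prod (-fderiv ℝ (fun r => fderiv ℝ G r (0, u)) q)) q :=
    (hasFDerivAt_const u q).prodMk h.hasFDerivAt.neg
  rw [h2.fderiv, ← fderiv_fderiv_apply_const hG]
  simp

lemma lieBracket_horLift (hG : ContDiffAt ℝ ∞ G q) (u v : E) :
    lieBracket ℝ (horLift G u) (horLift G v) q =
      (0, fderiv ℝ (fderiv ℝ G) q (horLift G v q) (0, u)
        - fderiv ℝ (fderiv ℝ G) q (horLift G u q) (0, v)) := by
  rw [lieBracket, fderiv_horLift_apply hG, fderiv_horLift_apply hG]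
  ext <;> simp
  abel

lemma fderiv_fderiv_apply_vert (hf : ContDiffAt ℝ ∞ f q) (ξ : E × E) :
    fderiv ℝ (fun r => fderiv ℝ f r (0, r.2)) q ξ
      = fderiv ℝ (fderiv ℝ f) q ξ (0, q.2) + fderiv ℝ f q (0, ξ.2) := by
  have h : HasFDerivAt (fun r : E × E => ((0 : E), r.2))
      ((0 : E × E →L[ℝ] E).prod (ContinuousLinearMap.snd ℝ E E)) q :=
    (hasFDerivAt_const (0 : E) q).prodMk hasFDerivAt_snd
  rw [fderiv_clm_apply ((contDiffAt_fderiv hf).differentiableAt (by simp)) h.differentiableAt,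
    h.fderiv]
  simp [add_comm]

lemma fderiv_fderiv_apply_horLift (hf : ContDiffAt ℝ ∞ f q) (hG : ContDiffAt ℝ ∞ G q) (u : E)
    (ξ : E × E) :
    fderiv ℝ (fun r => fderiv ℝ f r (horLift G u r)) q ξ
      = fderiv ℝ (fderiv ℝ f) q ξ (horLift G u q)
        - fderiv ℝ f q (0, fderiv ℝ (fderiv ℝ G) q ξ (0, u)) := by
  rw [fderiv_clm_apply ((contDiffAt_fderiv hf).differentiableAt (by simp))
    ((contDiffAt_horLift hG u).differentiableAt (by simp))]
  have : ∀ w : E, fderiv ℝ f q (0, -w) = - fderiv ℝ f q (0, w) := fun w => by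
    rw [← map_neg]; simp
  simp [fderiv_horLift_apply hG, this]
  abel

end Smooth

namespace Invariant

variable {G : E × E → E} {p : E × E → ℝ} {Ω : Set (E × E)} (h : Invariant G p Ω) {q : E × E}
  (hq : q ∈ Ω) (c : ℝ)
include h hq

lemma mem_nhds : Ω ∈ 𝓝 q := h.isOpen.mem_nhds hq

lemma contDiffAtG : ContDiffAt ℝ ∞ G q := h.smoothG.contDiffAt (h.mem_nhds hq)

lemma contDiffAt : ContDiffAt ℝ ∞ p q := h.smooth.contDiffAt (h.mem_nhds hq)

lemma contDiffAt_deform : ContDiffAt ℝ ∞ (deform c p G) q :=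
  Coord.contDiffAt_deform c (h.contDiffAtG hq) (h.contDiffAt hq)

lemma fderiv_congr {F : Type*} [NormedAddCommGroup F] [NormedSpace ℝ F] {f g : E × E → F}
    (hfg : ∀ r ∈ Ω, f r = g r) : fderiv ℝ f q = fderiv ℝ g q :=
  Filter.EventuallyEq.fderiv_eq (Filter.eventuallyEq_of_mem (h.mem_nhds hq) hfg)

/-- The derivative of the Euler relation of `G`. -/
lemma sndG_vert (ξ : E × E) :
    fderiv ℝ (fderiv ℝ G) q ξ (0, q.2) = (2 : ℝ) • fderiv ℝ G q ξ - fderiv ℝ G q (0, ξ.2) := by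
  rw [eq_sub_iff_add_eq, ← fderiv_fderiv_apply_vert (h.contDiffAtG hq),
    h.fderiv_congr hq h.homG, fderiv_fun_const_smul
      ((h.contDiffAtG hq).differentiableAt (by simp))]
  rfl

/-- The derivative of the Euler relation of `p`. -/
lemma snd_vert (ξ : E × E) :
    fderiv ℝ (fderiv ℝ p) q ξ (0, q.2) = fderiv ℝ p q ξ - fderiv ℝ p q (0, ξ.2) := by
  rw [eq_sub_iff_add_eq, ← fderiv_fderiv_apply_vert (h.contDiffAt hq), h.fderiv_congr hq h.hom]

/-- The derivative of the invariance of `p`. -/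
lemma snd_horLift (u : E) (ξ : E × E) :
    fderiv ℝ (fderiv ℝ p) q ξ (horLift G u q)
      = fderiv ℝ p q (0, fderiv ℝ (fderiv ℝ G) q ξ (0, u)) := by
  rw [← sub_eq_zero, ← fderiv_fderiv_apply_horLift (h.contDiffAt hq) (h.contDiffAtG hq),
    h.fderiv_congr hq (h.invariant u)]
  simp

lemma fderiv_deform (ξ : E × E) :
    fderiv ℝ (deform c p G) q ξ
      = fderiv ℝ G q ξ + c • (fderiv ℝ p q ξ • q.2 + p q • ξ.2) := by
  have hG := ((h.contDiffAtG hq).differentiableAt (by simp)).hasFDerivAt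
  have hp := ((h.contDiffAt hq).differentiableAt (by simp)).hasFDerivAt
  have := hG.add ((hp.const_mul c).smul (hasFDerivAt_snd (𝕜 := ℝ) (p := q)))
  rw [show fderiv ℝ (deform c p G) q = _ from this.fderiv]
  simp only [add_apply, smul_apply, ContinuousLinearMap.coe_snd', smul_eq_mul,
    ContinuousLinearMap.smulRight_apply]
  module

lemma nonlin_deform (u : E) :
    nonlin (deform c p G) q u
      = nonlin G q u + c • (fderiv ℝ p q (0, u) • q.2 + p q • u) :=
  h.fderiv_deform hq c (0, u)

lemma horLift_deform (u : E) :
    horLift (deform c p G) u q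
      = horLift G u q - c • (0, fderiv ℝ p q (0, u) • q.2 + p q • u) := by
  ext <;> simp [horLift, h.nonlin_deform hq c u]
  abel

lemma snd_deform (ξ : E × E) (v : E) :
    fderiv ℝ (fderiv ℝ (deform c p G)) q ξ (0, v)
      = fderiv ℝ (fderiv ℝ G) q ξ (0, v)
        + c • (fderiv ℝ (fderiv ℝ p) q ξ (0, v) • q.2 + fderiv ℝ p q (0, v) • ξ.2
          + fderiv ℝ p q ξ • v) := by
  rw [← fderiv_fderiv_apply_const (h.contDiffAt_deform hq c),
    h.fderiv_congr hq (fun r hr => h.fderiv_deform hr c (0, v)),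
    ← fderiv_fderiv_apply_const (h.contDiffAtG hq), ← fderiv_fderiv_apply_const (h.contDiffAt hq)]
  have hG : HasFDerivAt (fun r => fderiv ℝ G r (0, v)) _ q :=
    (((contDiffAt_fderiv (h.contDiffAtG hq)).clm_apply contDiffAt_const).differentiableAt
      (by simp)).hasFDerivAt
  have hp' : HasFDerivAt (fun r => fderiv ℝ p r (0, v)) _ q :=
    (((contDiffAt_fderiv (h.contDiffAt hq)).clm_apply contDiffAt_const).differentiableAt
      (by simp)).hasFDerivAt
  have hp := ((h.contDiffAt hq).differentiableAt (by simp)).hasFDerivAt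
  have := hG.add (((hp'.smul (hasFDerivAt_snd (𝕜 := ℝ) (p := q))).add
    (hp.smul_const v)).const_smul c)
  rw [show fderiv ℝ (fun r => fderiv ℝ G r (0, v)
    + c • (fderiv ℝ p r (0, v) • r.2 + p r • v)) q = _ from this.fderiv]
  simp only [add_apply, smul_apply, ContinuousLinearMap.coe_snd',
    ContinuousLinearMap.smulRight_apply]
  module

/-- The old lift kills `p`; the correction `-c (p_u y + p u)` contributes `p p_u` twice, once
through Euler's relation. So `p` is not invariant for the new connection, and this defect drives the
second bracket. -/
lemma fderiv_horLift_deform (u : E) :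
    fderiv ℝ p q (horLift (deform c p G) u q) = -(2 * c * p q) * fderiv ℝ p q (0, u) := by
  have e : (0, fderiv ℝ p q (0, u) • q.2 + p q • u)
      = fderiv ℝ p q (0, u) • ((0, q.2) : E × E) + p q • ((0, u) : E × E) := by ext <;> simp
  rw [h.horLift_deform hq, e]
  simp only [map_sub, map_smul, map_add, h.invariant u q hq, h.hom q hq, smul_eq_mul]
  ring

/-- The curvature of the deformed spray. -/
lemma lieBracket_deform (u v : E) :
    lieBracket ℝ (horLift (deform c p G) u) (horLift (deform c p G) v) q
      = lieBracket ℝ (horLift G u) (horLift G v) q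
        + (c ^ 2 * p q) • (0, fderiv ℝ p q (0, u) • v - fderiv ℝ p q (0, v) • u) := by
  have key : ∀ a b : E, fderiv ℝ (fderiv ℝ (deform c p G)) q (horLift (deform c p G) a q) (0, b)
      = fderiv ℝ (fderiv ℝ G) q (horLift G a q) (0, b)
        - (c * fderiv ℝ p q (0, a)) • nonlin G q b
        - (c * fderiv ℝ p q (0, b)) • nonlin G q a
        - (c * p q) • fderiv ℝ (fderiv ℝ G) q (0, a) (0, b)
        + (c * fderiv ℝ p q (0, fderiv ℝ (fderiv ℝ G) q (0, b) (0, a))) • q.2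
        - (c ^ 2 * p q * fderiv ℝ (fderiv ℝ p) q (0, a) (0, b)) • q.2
        - (c ^ 2 * fderiv ℝ p q (0, b) * fderiv ℝ p q (0, a)) • q.2
        - (c ^ 2 * p q * fderiv ℝ p q (0, b)) • a
        - (2 * c ^ 2 * p q * fderiv ℝ p q (0, a)) • b := by
    intro a b
    have e : (0, fderiv ℝ p q (0, a) • q.2 + p q • a)
        = fderiv ℝ p q (0, a) • ((0, q.2) : E × E) + p q • ((0, a) : E × E) := by ext <;> simp
    rw [h.snd_deform hq, h.fderiv_horLift_deform hq, h.horLift_deform hq, e]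
    simp only [map_sub, map_smul, map_add, sub_apply, smul_apply, add_apply]
    rw [fderiv_fderiv_comm (h.contDiffAtG hq) (0, q.2), h.sndG_vert hq,
      fderiv_fderiv_comm (h.contDiffAt hq) (0, q.2), h.snd_vert hq,
      fderiv_fderiv_comm (h.contDiffAt hq) (horLift G a q), h.snd_horLift hq]
    simp only [Prod.snd_sub, Prod.snd_add, Prod.smul_snd, horLift, ← nonlin_apply, sub_self,
      smul_eq_mul]
    module
  -- In the difference of the two instances of `key` every correction symmetric in `a`, `b` cancels.
  -- Only the last two terms survive, with coefficients 1 and 2, leaving a net factor `c² p`.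
  rw [lieBracket_horLift (h.contDiffAt_deform hq c), lieBracket_horLift (h.contDiffAtG hq), key,
    key, fderiv_fderiv_comm (h.contDiffAtG hq) (0, u), fderiv_fderiv_comm (h.contDiffAt hq) (0, u)]
  ext
  · simp
  · simp only [Prod.snd_add, Prod.smul_snd]
    module

/-- Fields tangent to the level sets of `p` have a bracket tangent to them. -/
lemma fderiv_lieBracket_horLift (u v : E) :
    fderiv ℝ p q (lieBracket ℝ (horLift G u) (horLift G v) q) = 0 := by
  rw [fderiv_apply_lieBracket (h.contDiffAt hq) minSmoothness_two_le
    ((contDiffAt_horLift (h.contDiffAtG hq) _).differentiableAt (by simp))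
    ((contDiffAt_horLift (h.contDiffAtG hq) _).differentiableAt (by simp)),
    h.fderiv_congr hq (h.invariant u), h.fderiv_congr hq (h.invariant v)]
  simp

/-- The deformed lifts are not tangent to the level sets of `p`, yet their bracket is: `dp` sends
the extra curvature term to a multiple of `p_u p_v - p_v p_u`. -/
lemma fderiv_lieBracket_deform (u v : E) :
    fderiv ℝ p q (lieBracket ℝ (horLift (deform c p G) u) (horLift (deform c p G) v) q) = 0 := by
  have e : (0, fderiv ℝ p q (0, u) • v - fderiv ℝ p q (0, v) • u)
      = fderiv ℝ p q (0, u) • ((0, v) : E × E) - fderiv ℝ p q (0, v) • ((0, u) : E × E) := by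
    ext <;> simp
  rw [h.lieBracket_deform hq, e]
  simp only [map_sub, map_smul, map_add, h.fderiv_lieBracket_horLift hq, smul_eq_mul]
  ring

lemma contDiffAt_lieBracket_deform (u v : E) :
    ContDiffAt ℝ ∞ (lieBracket ℝ (horLift (deform c p G) u) (horLift (deform c p G) v)) q :=
  (contDiffAt_horLift (h.contDiffAt_deform hq c) u).lieBracket_vectorField
    (contDiffAt_horLift (h.contDiffAt_deform hq c) v) (by simp)

/-- The iterated bracket is transverse to the level sets of `p` where `p` is nonlinear. -/
lemma fderiv_lieBracket_lieBracket_deform (u v w : E) :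
    fderiv ℝ p q (lieBracket ℝ (horLift (deform c p G) w)
        (lieBracket ℝ (horLift (deform c p G) u) (horLift (deform c p G) v)) q)
      = 2 * c * p q * fderiv ℝ (fderiv ℝ p) q
        (lieBracket ℝ (horLift (deform c p G) u) (horLift (deform c p G) v) q) (0, w) := by
  set Y := lieBracket ℝ (horLift (deform c p G) u) (horLift (deform c p G) v) with hY
  have hYs : DifferentiableAt ℝ Y q :=
    (h.contDiffAt_lieBracket_deform hq c u v).differentiableAt (by simp)
  have hYp : fderiv ℝ p q (Y q) = 0 := h.fderiv_lieBracket_deform hq c u v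
  -- With `Y p = 0` near `q`, only `-Y(δ'_w p) = Y(2 c p p_w)` remains, and the part differentiating
  -- `p` vanishes again by `Y p = 0`.
  rw [fderiv_apply_lieBracket (h.contDiffAt hq) minSmoothness_two_le hYs
    ((contDiffAt_horLift (h.contDiffAt_deform hq c) _).differentiableAt (by simp)),
    h.fderiv_congr hq (fun r hr => h.fderiv_lieBracket_deform hr c u v),
    h.fderiv_congr hq (fun r hr => h.fderiv_horLift_deform hr c w),
    ← fderiv_fderiv_apply_const (h.contDiffAt hq)]
  have hp' : HasFDerivAt (fun r => fderiv ℝ p r (0, w)) _ q :=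
    (((contDiffAt_fderiv (h.contDiffAt hq)).clm_apply contDiffAt_const).differentiableAt
      (by simp)).hasFDerivAt
  have hp := ((h.contDiffAt hq).differentiableAt (by simp)).hasFDerivAt
  have := ((hp.const_mul (2 * c)).neg).mul hp'
  rw [show fderiv ℝ (fun r => -(2 * c * p r) * fderiv ℝ p r (0, w)) q = _ from this.fderiv]
  simp [hYp]

/-- The inner bracket is vertical throughout `Ω`, and a lift has constant first component, so
neither term of the outer bracket has a horizontal coordinate. -/
lemma fst_lieBracket_lieBracket_deform (u v w : E) :
    (lieBracket ℝ (horLift (deform c p G) w)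
        (lieBracket ℝ (horLift (deform c p G) u) (horLift (deform c p G) v)) q).1 = 0 := by
  have hYs := (h.contDiffAt_lieBracket_deform hq c u v).differentiableAt (by simp)
  have h1 := h.fderiv_congr hq (f := fun r =>
    (lieBracket ℝ (horLift (deform c p G) u) (horLift (deform c p G) v) r).1) (g := fun _ => 0)
    (fun r hr => by rw [lieBracket_horLift (h.contDiffAt_deform hr c)])
  have h2 := (hasFDerivAt_fst.comp q hYs.hasFDerivAt).fderiv
  have h3 := h2.symm.trans h1
  rw [lieBracket, fderiv_horLift_apply (h.contDiffAt_deform hq c)]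
  simpa using! congrArg (fun L => L (horLift (deform c p G) w q)) h3

/-- The Jacobi endomorphism in coordinates. -/
lemma lieBracket_spray (v : E) {S : E × E → E × E} (hS : ∀ r ∈ Ω, S r = (r.2, (-2 : ℝ) • G r)) :
    (lieBracket ℝ S (horLift G v) q).2 + nonlin G q (lieBracket ℝ S (horLift G v) q).1
      = (lieBracket ℝ (horLift G q.2) (horLift G v) q).2 := by
  -- `S` is `δ_y` with variable `y`. Freezing `y` at its value in `q` changes the bracket with `δ_v`
  -- by a horizontal vector only, which the left-hand side discards.
  have hSd : fderiv ℝ S q = _ := (h.fderiv_congr hq hS).trans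
    (hasFDerivAt_snd.prodMk (((h.contDiffAtG hq).differentiableAt
      (by simp)).hasFDerivAt.const_smul (-2 : ℝ))).fderiv
  have hSq : S q = horLift G q.2 q := by
    simp [hS q hq, horLift, nonlin_apply, h.homG q hq]
  rw [lieBracket_horLift (h.contDiffAtG hq), lieBracket, fderiv_horLift_apply (h.contDiffAtG hq),
    hSd, hSq, h.sndG_vert hq]
  simp [horLift, nonlin_apply]
  rw [show ((0 : E), -fderiv ℝ G q (0, v)) = -(0, fderiv ℝ G q (0, v)) by simp, map_neg]
  module

/-- The eigenvalue condition makes `Φ + c² p²` bijective, and this operator maps the kernel of the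
vertical differential of `p` onto itself; there it coincides with the deformed curvature `[δ'_y,
δ'_v]`. -/
lemma exists_lieBracket_eq_vertical [FiniteDimensional ℝ E]
    (hκ : ∀ (κ : ℝ) (v : E), v ≠ 0 →
      (lieBracket ℝ (horLift G q.2) (horLift G v) q).2 = κ • v → κ + c ^ 2 * p q ^ 2 ≠ 0)
    (hy : q.2 ≠ 0) :
    c * p q ≠ 0 ∧ ∀ w : E, fderiv ℝ p q (0, w) = 0 → ∃ v,
      lieBracket ℝ (horLift (deform c p G) q.2) (horLift (deform c p G) v) q = (0, w) := by
  have hcp : c * p q ≠ 0 := by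
    intro h0
    -- The vector `y` is an eigenvector with `κ = 0`, so the condition reads `c² p² ≠ 0`.
    refine hκ 0 q.2 hy ?_ ?_
    · rw [lieBracket_self]; simp
    · rw [zero_add, ← mul_pow, h0]; simp
  refine ⟨hcp, fun w hw => ?_⟩
  let A : E →ₗ[ℝ] E :=
    { toFun := fun v => (lieBracket ℝ (horLift G q.2) (horLift G v) q).2 + (c ^ 2 * p q ^ 2) • v
      map_add' := fun a b => by
        have e : ∀ a b : E, ((0 : E), a + b) = (0, a) + (0, b) := by simp
        have e' : horLift G (a + b) q = horLift G a q + horLift G b q := by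
          ext <;> simp [horLift]; abel
        simp only [lieBracket_horLift (h.contDiffAtG hq), e, e', map_add, add_apply]
        module
      map_smul' := fun t a => by
        have e : ∀ a : E, ((0 : E), t • a) = t • (0, a) := by simp
        have e' : horLift G (t • a) q = t • horLift G a q := by
          ext <;> simp [horLift]
        simp only [lieBracket_horLift (h.contDiffAtG hq), e, e', map_smul, smul_apply,
          RingHom.id_apply]
        module }
  have hA : Function.Injective A := by
    rw [injective_iff_map_eq_zero]
    intro v hv
    by_contra hv0
    -- A nonzero kernel vector of `A` would be an eigenvector for exactly the excluded value.
    refine hκ (-(c ^ 2 * p q ^ 2)) v hv0 ?_ (by ring)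
    rw [neg_smul]
    exact eq_neg_of_add_eq_zero_left hv
  obtain ⟨v, hv⟩ := LinearMap.injective_iff_surjective.1 hA w
  have hv' : (lieBracket ℝ (horLift G q.2) (horLift G v) q).2 + (c ^ 2 * p q ^ 2) • v = w := hv
  have e : ∀ a b : E, ((0 : E), a + b) = (0, a) + (0, b) := by simp
  have e' : lieBracket ℝ (horLift G q.2) (horLift G v) q
      = (0, (lieBracket ℝ (horLift G q.2) (horLift G v) q).2) := by
    rw [lieBracket_horLift (h.contDiffAtG hq)]
  -- Applying `dp` to `A v = w` kills the curvature term and leaves `(c p)² p_v = p_w = 0`.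
  have hpv : fderiv ℝ p q (0, v) = 0 := by
    have h1 : fderiv ℝ p q ((0, w) : E × E) = (c * p q) ^ 2 * fderiv ℝ p q (0, v) := by
      rw [← hv', e, ← e', map_add, h.fderiv_lieBracket_horLift hq,
        show ((0 : E), (c ^ 2 * p q ^ 2) • v) = (c ^ 2 * p q ^ 2) • (0, v) by simp, map_smul]
      simp only [zero_add, smul_eq_mul]; ring
    rw [hw] at h1
    simpa [hcp] using h1.symm
  refine ⟨v, ?_⟩
  rw [h.lieBracket_deform hq, hpv, h.hom q hq, e', ← hv']
  ext
  · simp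
  · simp [smul_smul]; ring_nf

/-- A subspace containing the horizontal vectors of the deformed spray and their first and second
brackets is everything. -/
theorem eq_top_of_mem [FiniteDimensional ℝ E]
    (hκ : ∀ (κ : ℝ) (v : E), v ≠ 0 →
      (lieBracket ℝ (horLift G q.2) (horLift G v) q).2 = κ • v → κ + c ^ 2 * p q ^ 2 ≠ 0)
    (hy : q.2 ≠ 0) (hnl : ∃ a w : E, fderiv ℝ (fderiv ℝ p) q (0, a) (0, w) ≠ 0)
    {K : Submodule ℝ (E × E)} (h1 : ∀ u, horLift (deform c p G) u q ∈ K)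
    (h2 : ∀ u v, lieBracket ℝ (horLift (deform c p G) u) (horLift (deform c p G) v) q ∈ K)
    (h3 : ∀ u v w, lieBracket ℝ (horLift (deform c p G) w)
      (lieBracket ℝ (horLift (deform c p G) u) (horLift (deform c p G) v)) q ∈ K) : K = ⊤ := by
  obtain ⟨hcp, hker⟩ := h.exists_lieBracket_eq_vertical hq c hκ hy
  have hp0 : p q ≠ 0 := right_ne_zero_of_mul hcp
  have hkerK : ∀ w : E, fderiv ℝ p q (0, w) = 0 → ((0, w) : E × E) ∈ K := fun w hw => by
    obtain ⟨v, hv⟩ := hker w hw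
    exact hv ▸ h2 q.2 v
  obtain ⟨a, w, haw⟩ := hnl
  -- Subtracting this multiple of `y` moves `a` into the kernel, because `p_y = p`; it leaves
  -- `p_{aw}` unchanged, because `p_{yw} = 0`.
  obtain ⟨v, hv⟩ := hker (a - (fderiv ℝ p q (0, a) / p q) • q.2) (by
    rw [show ((0 : E), a - (fderiv ℝ p q (0, a) / p q) • q.2)
      = (0, a) - (fderiv ℝ p q (0, a) / p q) • (0, q.2) by simp, map_sub, map_smul, h.hom q hq]
    simp [hp0])
  obtain ⟨b, hb, hpb⟩ : ∃ b : E, ((0, b) : E × E) ∈ K ∧ fderiv ℝ p q (0, b) ≠ 0 := by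
    have hf := h.fst_lieBracket_lieBracket_deform hq c q.2 v w
    have hs := h.fderiv_lieBracket_lieBracket_deform hq c q.2 v w
    refine ⟨(lieBracket ℝ (horLift (deform c p G) w) (lieBracket ℝ (horLift (deform c p G) q.2)
      (horLift (deform c p G) v)) q).2, ?_, ?_⟩
    · have := h3 q.2 v w
      rwa [← Prod.mk.eta (p := lieBracket ℝ (horLift (deform c p G) w) _ q), hf] at this
    · rw [← hf, Prod.mk.eta, hs, hv, show ((0 : E), a - (fderiv ℝ p q (0, a) / p q) • q.2)
        = (0, a) - (fderiv ℝ p q (0, a) / p q) • (0, q.2) by simp, map_sub, map_smul, sub_apply,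
        smul_apply, fderiv_fderiv_comm (h.contDiffAt hq) (0, q.2), h.snd_vert hq]
      simp only [sub_self, smul_zero, sub_zero]
      exact mul_ne_zero (by rw [mul_assoc]; exact mul_ne_zero two_ne_zero hcp) haw
  -- The kernel is a hyperplane of the vertical space, and `b` spans a complement.
  have hvert : ∀ w : E, ((0, w) : E × E) ∈ K := fun w => by
    have e : ((0, w) : E × E) = (0, w - (fderiv ℝ p q (0, w) / fderiv ℝ p q (0, b)) • b)
        + (fderiv ℝ p q (0, w) / fderiv ℝ p q (0, b)) • (0, b) := by simp
    rw [e]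
    refine K.add_mem (hkerK _ ?_) (K.smul_mem _ hb)
    rw [show ((0 : E), w - (fderiv ℝ p q (0, w) / fderiv ℝ p q (0, b)) • b)
      = (0, w) - (fderiv ℝ p q (0, w) / fderiv ℝ p q (0, b)) • (0, b) by simp, map_sub, map_smul]
    simp [hpb]
  rw [eq_top_iff]
  rintro ⟨u, w⟩ -
  have e : (u, w) = horLift (deform c p G) u q + (0, w + nonlin (deform c p G) q u) := by
    simp [horLift]
  rw [e]
  exact K.add_mem (h1 u) (hvert _)

end Invariant

end Coord

/-! ### Transport of vector fields, brackets and `J` through a chart of `TM`. -/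

section Chart

open VectorField

variable {n : ℕ} {M : Type*} [TopologicalSpace M] [ChartedSpace (Fibre n) M]
  [IsManifold (𝓡 n) ∞ M]

lemma mlieBracket_eq_lieBracket {E : Type*} [NormedAddCommGroup E] [NormedSpace ℝ E]
    (V W : E → E) : mlieBracket 𝓘(ℝ, E) V W = lieBracket ℝ V W := by
  have := mlieBracketWithin_eq_lieBracketWithin (𝕜 := ℝ) (V := V) (W := W) (s := Set.univ)
  exact this.trans lieBracketWithin_univ

/-- The chart of `TM` centred at `z`. -/
abbrev chart (z : TangentBundle (𝓡 n) M) :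
    PartialEquiv (TangentBundle (𝓡 n) M) (Fibre n × Fibre n) :=
  extChartAt (modelTM n) z

/-- The derivative of the chart. -/
def dchart (z p : TangentBundle (𝓡 n) M) :
    TangentSpace (modelTM n) p →L[ℝ] Fibre n × Fibre n :=
  mfderiv (modelTM n) 𝓘(ℝ, Fibre n × Fibre n) (chart z) p

/-- The coordinate expression of a field. -/
def hat (z : TangentBundle (𝓡 n) M) (X : Field n M) : Fibre n × Fibre n → Fibre n × Fibre n :=
  mpullback 𝓘(ℝ, Fibre n × Fibre n) (modelTM n) (chart z).symm X

/-- The field with a given coordinate expression. -/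
def lift (z : TangentBundle (𝓡 n) M) (Y : Fibre n × Fibre n → Fibre n × Fibre n) : Field n M :=
  mpullback (modelTM n) 𝓘(ℝ, Fibre n × Fibre n) (chart z) Y

/-- Smoothness of a field at a point. -/
def SmoothAt (X : Field n M) (p : TangentBundle (𝓡 n) M) : Prop :=
  ContMDiffAt (modelTM n) (modelTM n).tangent ∞
    (fun z => (⟨z, X z⟩ : TangentBundle (modelTM n) (TangentBundle (𝓡 n) M))) p

lemma SmoothOn.smoothAt {X : Field n M} {W : Set (TangentBundle (𝓡 n) M)}
    {p : TangentBundle (𝓡 n) M} (h : SmoothOn X W) (hW : W ∈ 𝓝 p) : SmoothAt X p :=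
  ContMDiffOn.contMDiffAt h hW

lemma SmoothAt.congr {X Y : Field n M} {p : TangentBundle (𝓡 n) M} (h : SmoothAt X p)
    (hXY : Y =ᶠ[𝓝 p] X) : SmoothAt Y p :=
  ContMDiffAt.congr_of_eventuallyEq h (hXY.mono fun r hr => by simp only [hr])

lemma SmoothAt.mdifferentiableAt {X : Field n M} {p : TangentBundle (𝓡 n) M} (h : SmoothAt X p) :
    MDifferentiableAt (modelTM n) (modelTM n).tangent
      (fun z => (⟨z, X z⟩ : TangentBundle (modelTM n) (TangentBundle (𝓡 n) M))) p :=
  ContMDiffAt.mdifferentiableAt h (by simp)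

variable (z : TangentBundle (𝓡 n) M)

lemma mem_chart_source {p : TangentBundle (𝓡 n) M} :
    p ∈ (chart z).source ↔ p.1 ∈ (extChartAt (𝓡 n) z.1).source := by
  simp

lemma isOpen_chart_source : IsOpen (chart z).source := isOpen_extChartAt_source z

lemma isOpen_chart_target : IsOpen (chart z).target := isOpen_extChartAt_target z

/-- Exhibits the chart as linear on fibres, which is what makes `J`, `𝒞`, the slit bundle and
homogeneity take their standard coordinate form. -/
lemma chart_apply {p : TangentBundle (𝓡 n) M} (hp : p ∈ (chart z).source) :
    chart z p = (extChartAt (𝓡 n) z.1 p.1,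
      mfderiv (𝓡 n) 𝓘(ℝ, Fibre n) (extChartAt (𝓡 n) z.1) p.1 p.2) := by
  rw [← TangentBundle.continuousLinearMapAt_trivializationAt (by simpa using hp),
    TangentBundle.continuousLinearMapAt_trivializationAt_eq_core (by simpa using hp)]
  rfl

lemma chart_self : chart z z = (extChartAt (𝓡 n) z.1 z.1, z.2) := by
  rw [chart_apply z (by simp), mfderiv_extChartAt_self]
  rfl

variable {z} {p : TangentBundle (𝓡 n) M} (hp : p ∈ (chart z).source)
include hp

lemma contMDiffAt_chart : ContMDiffAt (modelTM n) 𝓘(ℝ, Fibre n × Fibre n) ∞ (chart z) p :=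
  contMDiffAt_extChartAt' (by rwa [← extChartAt_source (modelTM n)])

lemma chart_target_mem_nhds : (chart z).target ∈ 𝓝 (chart z p) :=
  (isOpen_chart_target z).mem_nhds ((chart z).map_source hp)

lemma contMDiffAt_chart_symm :
    ContMDiffAt 𝓘(ℝ, Fibre n × Fibre n) (modelTM n) ∞ (chart z).symm (chart z p) :=
  (contMDiffOn_extChartAt_symm z).contMDiffAt (chart_target_mem_nhds hp)

lemma continuousAt_chart : ContinuousAt (chart z) p := (contMDiffAt_chart hp).continuousAt

lemma isInvertible_dchart : (dchart z p).IsInvertible := isInvertible_mfderiv_extChartAt hp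

lemma isInvertible_mfderiv_chart_symm :
    (mfderiv 𝓘(ℝ, Fibre n × Fibre n) (modelTM n) (chart z).symm (chart z p)).IsInvertible := by
  have := isInvertible_mfderivWithin_extChartAt_symm (I := modelTM n) ((chart z).map_source hp)
  rwa [ModelWithCorners.Boundaryless.range_eq_univ, mfderivWithin_univ] at this

lemma dchart_injective : Function.Injective (dchart z p) := (isInvertible_dchart hp).injective

lemma dchart_lift (Y : Fibre n × Fibre n → Fibre n × Fibre n) :
    dchart z p (lift z Y p) = Y (chart z p) :=
  (isInvertible_dchart hp).self_apply_inverse (Y (chart z p))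

lemma hat_chart (X : Field n M) : hat z X (chart z p) = dchart z p (X p) := by
  -- The points `(chart z).symm (chart z p)` and `p` are only propositionally equal, so the
  -- dependence of the tangent space on the point is generalised first.
  have h1 : ∀ p' (_ : p' = p), dchart z p' (X p') = dchart z p (X p) := by
    rintro _ rfl; rfl
  rw [← h1 _ ((chart z).left_inv hp)]
  have h2 := mfderiv_extChartAt_comp_mfderivWithin_extChartAt_symm (I := modelTM n) (x := z)
    ((chart z).map_source hp)
  rw [ModelWithCorners.Boundaryless.range_eq_univ, mfderivWithin_univ] at h2
  have h3 := isInvertible_mfderiv_chart_symm hp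
  have h4 := congrArg (fun L => L (hat z X (chart z p))) h2
  have h5 : mfderiv 𝓘(ℝ, Fibre n × Fibre n) (modelTM n) (chart z).symm (chart z p)
    (hat z X (chart z p)) = X ((chart z).symm (chart z p)) := h3.self_apply_inverse _
  rw [← h5]
  exact h4.symm

lemma hat_lift (Y : Fibre n × Fibre n → Fibre n × Fibre n) :
    hat z (lift z Y) (chart z p) = Y (chart z p) := by
  rw [hat_chart hp, dchart_lift hp]

lemma eventually_chart {P : Fibre n × Fibre n → Prop} (h : ∀ᶠ q in 𝓝 (chart z p), P q) :
    ∀ᶠ r in 𝓝 p, r ∈ (chart z).source ∧ P (chart z r) :=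
  Filter.Eventually.and (Filter.eventually_mem_set.2 ((isOpen_chart_source z).mem_nhds hp))
    ((continuousAt_chart hp).eventually h)

lemma eventually_of_chart {P : TangentBundle (𝓡 n) M → Prop} (h : ∀ᶠ r in 𝓝 p, P r) :
    ∀ᶠ q in 𝓝 (chart z p), q ∈ (chart z).target ∧ P ((chart z).symm q) := by
  refine Filter.Eventually.and (Filter.eventually_mem_set.2 (chart_target_mem_nhds hp)) ?_
  have := (contMDiffAt_chart_symm hp).continuousAt
  rw [ContinuousAt, (chart z).left_inv hp] at this
  exact this.eventually h

lemma SmoothAt.hat {X : Field n M} (h : SmoothAt X p) : ContDiffAt ℝ ∞ (hat z X) (chart z p) := by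
  refine contMDiffAt_vectorSpace_iff_contDiffAt.1 ?_
  refine ContMDiffAt.mpullback_vectorField_preimage (n := ∞) ?_ (contMDiffAt_chart_symm hp)
    (isInvertible_mfderiv_chart_symm hp) (by simp)
  rw [(chart z).left_inv hp]
  exact h

lemma smoothAt_lift {Y : Fibre n × Fibre n → Fibre n × Fibre n}
    (h : ContDiffAt ℝ ∞ Y (chart z p)) : SmoothAt (lift z Y) p :=
  ContMDiffAt.mpullback_vectorField_preimage (n := ∞)
    (contMDiffAt_vectorSpace_iff_contDiffAt.2 h) (contMDiffAt_chart hp)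
    (isInvertible_dchart hp) (by simp)

lemma lift_eventuallyEq {X : Field n M} {Y : Fibre n × Fibre n → Fibre n × Fibre n}
    (h : hat z X =ᶠ[𝓝 (chart z p)] Y) : X =ᶠ[𝓝 p] lift z Y := by
  filter_upwards [eventually_chart hp h] with r hr
  exact dchart_injective hr.1 (by rw [dchart_lift hr.1, ← hr.2, hat_chart hr.1])

lemma smoothAt_of_hat {X : Field n M} (h : ContDiffAt ℝ ∞ (hat z X) (chart z p)) :
    SmoothAt X p :=
  (smoothAt_lift hp h).congr (lift_eventuallyEq hp .rfl)

lemma hat_bracket {X Y : Field n M} (hX : SmoothAt X p) (hY : SmoothAt Y p) :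
    hat z (bracket X Y) (chart z p) = lieBracket ℝ (hat z X) (hat z Y) (chart z p) := by
  have e := (chart z).left_inv hp
  have : IsManifold (modelTM n) (minSmoothness ℝ 2) (TangentBundle (𝓡 n) M) :=
    .of_le Coord.minSmoothness_two_le
  have : IsManifold 𝓘(ℝ, Fibre n × Fibre n) (minSmoothness ℝ 2) (Fibre n × Fibre n) :=
    .of_le Coord.minSmoothness_two_le
  have := mpullback_mlieBracket (I := 𝓘(ℝ, Fibre n × Fibre n)) (I' := modelTM n)
    (f := (chart z).symm) (x₀ := chart z p) (V := X) (W := Y) (n := ∞)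
    (by rw [e]; exact hX.mdifferentiableAt) (by rw [e]; exact hY.mdifferentiableAt)
    (contMDiffAt_chart_symm hp) Coord.minSmoothness_two_le
  exact this.trans (congrFun (mlieBracket_eq_lieBracket _ _) _)

lemma hat_bracket_eventuallyEq {X Y : Field n M} (hX : ∀ᶠ r in 𝓝 p, SmoothAt X r)
    (hY : ∀ᶠ r in 𝓝 p, SmoothAt Y r) :
    hat z (bracket X Y) =ᶠ[𝓝 (chart z p)] lieBracket ℝ (hat z X) (hat z Y) := by
  filter_upwards [eventually_of_chart hp (hX.and hY)] with q hq
  have := hat_bracket ((chart z).map_target hq.1) hq.2.1 hq.2.2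
  rwa [(chart z).right_inv hq.1] at this

lemma smoothAt_bracket {X Y : Field n M} (hX : ∀ᶠ r in 𝓝 p, SmoothAt X r)
    (hY : ∀ᶠ r in 𝓝 p, SmoothAt Y r) : SmoothAt (bracket X Y) p :=
  smoothAt_of_hat hp (((hX.self_of_nhds.hat hp).lieBracket_vectorField (hY.self_of_nhds.hat hp)
    (by simp)).congr_of_eventuallyEq (hat_bracket_eventuallyEq hp hX hY))

lemma dchart_fst (ξ : TangentSpace (modelTM n) p) :
    (dchart z p ξ).1 = (mfderiv (𝓡 n) 𝓘(ℝ, Fibre n) (extChartAt (𝓡 n) z.1) p.1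
      (mfderiv (modelTM n) (𝓡 n) (fun p : TangentBundle (𝓡 n) M => p.1) p ξ) : Fibre n) := by
  have hπ : MDifferentiableAt (modelTM n) (𝓡 n) (fun p : TangentBundle (𝓡 n) M => p.1) p :=
    (Bundle.contMDiff_proj (TangentSpace (𝓡 n) : M → Type _) (n := ∞)).contMDiffAt
      |>.mdifferentiableAt (by simp)
  have hx : MDifferentiableAt (𝓡 n) 𝓘(ℝ, Fibre n) (extChartAt (𝓡 n) z.1) p.1 :=
    mdifferentiableAt_extChartAt (by simpa using hp)
  have h1 := mfderiv_comp p hx hπ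
  have h2 : (extChartAt (𝓡 n) z.1 ∘ fun p : TangentBundle (𝓡 n) M => p.1)
      =ᶠ[𝓝 p] Prod.fst ∘ chart z := by
    filter_upwards [(isOpen_chart_source z).mem_nhds hp] with r hr
    simp only [Function.comp_apply, chart_apply z hr]
  have h3 := mfderiv_comp p (g := (Prod.fst : Fibre n × Fibre n → Fibre n))
    (I'' := 𝓘(ℝ, Fibre n)) (I' := 𝓘(ℝ, Fibre n × Fibre n))
    (differentiableAt_fst.mdifferentiableAt) ((contMDiffAt_chart hp).mdifferentiableAt (by simp))
  rw [h2.mfderiv_eq, h3] at h1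
  have h4 := congrArg (fun L => L ξ) h1
  have h5 : ∀ η : Fibre n × Fibre n, mfderiv 𝓘(ℝ, Fibre n × Fibre n) 𝓘(ℝ, Fibre n)
      (Prod.fst : Fibre n × Fibre n → Fibre n) (chart z p) η = η.1 := fun η => by
    rw [mfderiv_eq_fderiv, fderiv_fst]
    rfl
  exact (h5 _).symm.trans h4

lemma dchart_verticalLift (w : TangentSpace (𝓡 n) p.1) :
    dchart z p (verticalLift p w) =
      (0, (mfderiv (𝓡 n) 𝓘(ℝ, Fibre n) (extChartAt (𝓡 n) z.1) p.1 w : Fibre n)) := by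
  let L : Fibre n →L[ℝ] Fibre n := mfderiv (𝓡 n) 𝓘(ℝ, Fibre n) (extChartAt (𝓡 n) z.1) p.1
  let y : Fibre n := p.2
  let ι : Fibre n → TangentBundle (𝓡 n) M := fun y => ⟨p.1, y⟩
  let f : Fibre n → Fibre n × Fibre n := fun y => (extChartAt (𝓡 n) z.1 p.1, L y)
  have hι : ∀ y, ι y ∈ (chart z).source := fun y => by
    rw [mem_chart_source] at hp ⊢; exact hp
  have hf : chart z ∘ ι = f := funext fun y => chart_apply z (hι y)
  -- Differentiability of the fibre inclusion is obtained from its affine coordinate expression `f`.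
  have hιf : ι = (chart z).symm ∘ f := by
    rw [← hf]
    exact funext fun y => ((chart z).left_inv (hι y)).symm
  have hfd : HasFDerivAt f ((0 : Fibre n →L[ℝ] Fibre n).prod L) y :=
    (hasFDerivAt_const _ _).prodMk L.hasFDerivAt
  have hfp : f y = chart z p := congrFun hf.symm y
  have hιd : MDifferentiableAt 𝓘(ℝ, Fibre n) (modelTM n) ι y := by
    rw [hιf]
    refine MDifferentiableAt.comp (I' := 𝓘(ℝ, Fibre n × Fibre n)) _ ?_
      hfd.differentiableAt.mdifferentiableAt
    rw [hfp]
    exact (contMDiffAt_chart_symm hp).mdifferentiableAt (by simp)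
  have h1 : mfderiv 𝓘(ℝ, Fibre n) 𝓘(ℝ, Fibre n × Fibre n) (chart z ∘ ι) y = _ :=
    mfderiv_comp y (g := chart z) (I'' := 𝓘(ℝ, Fibre n × Fibre n))
    ((contMDiffAt_chart hp).mdifferentiableAt (by simp)) hιd
  have h2 : mfderiv 𝓘(ℝ, Fibre n) 𝓘(ℝ, Fibre n × Fibre n) f y = fderiv ℝ f y := mfderiv_eq_fderiv
  rw [hf, h2, hfd.fderiv] at h1
  exact (congrArg (fun L => L w) h1).symm

lemma dchart_J (X : Field n M) : dchart z p (J X p) = (0, (dchart z p (X p)).1) := by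
  rw [J, dchart_verticalLift hp, dchart_fst hp]
  rfl

lemma hat_J (X : Field n M) : hat z (J X) (chart z p) = (0, (hat z X (chart z p)).1) := by
  rw [hat_chart hp, hat_chart hp, dchart_J hp]

lemma hat_liouville : hat z liouville (chart z p) = (0, (chart z p).2) := by
  rw [hat_chart hp, liouville, dchart_verticalLift hp, chart_apply z hp]
  rfl

lemma mem_slit_iff : p ∈ slit n M ↔ (chart z p).2 ≠ 0 := by
  rw [chart_apply z hp]
  have : (mfderiv (𝓡 n) 𝓘(ℝ, Fibre n) (extChartAt (𝓡 n) z.1) p.1).IsInvertible :=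
    isInvertible_mfderiv_extChartAt ((mem_chart_source z).1 hp)
  exact (map_ne_zero_iff _ this.injective).symm

end Chart

/-! ### Horizontal projector and holonomy distribution of a spray in coordinates. -/

section LocalSpray

open VectorField

namespace Coord

/-- The coordinate expression of `Γ = [J, S]`. -/
lemma lieBracket_vert_sub {E : Type*} [NormedAddCommGroup E] [NormedSpace ℝ E] {G : E × E → E}
    {S Y V : E × E → E × E} {q : E × E} (hG : DifferentiableAt ℝ G q)
    (hS : S =ᶠ[𝓝 q] fun r => (r.2, (-2 : ℝ) • G r)) (hY : DifferentiableAt ℝ Y q)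
    (hV : V =ᶠ[𝓝 q] fun r => (0, (Y r).1)) :
    lieBracket ℝ V S q - (0, (lieBracket ℝ Y S q).1)
      = ((Y q).1, (-2 : ℝ) • nonlin G q (Y q).1 - (Y q).2) := by
  have hSd : fderiv ℝ S q = _ := hS.fderiv_eq.trans
    (hasFDerivAt_snd.prodMk (hG.hasFDerivAt.const_smul (-2 : ℝ))).fderiv
  have hVd : fderiv ℝ V q = _ := hV.fderiv_eq.trans
    ((hasFDerivAt_const (0 : E) q).prodMk (hasFDerivAt_fst.comp q hY.hasFDerivAt)).fderiv
  rw [lieBracket, lieBracket, hSd, hVd, hS.self_of_nhds, hV.self_of_nhds]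
  ext <;> simp [nonlin_apply]

end Coord

variable {n : ℕ} {M : Type*} [TopologicalSpace M] [ChartedSpace (Fibre n) M]
  [IsManifold (𝓡 n) ∞ M]

/-- In the chart centred at `z` the field `S` is `(y, -2 G)` on `Ω`. -/
structure IsLocalSpray (z : TangentBundle (𝓡 n) M) (S : Field n M)
    (G : Fibre n × Fibre n → Fibre n) (Ω : Set (Fibre n × Fibre n)) : Prop where
  isOpen : IsOpen Ω
  subset : Ω ⊆ (chart z).target
  ne_zero : ∀ q ∈ Ω, q.2 ≠ 0
  smooth : ContDiffOn ℝ ∞ G Ω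
  hat_eq : ∀ q ∈ Ω, hat z S q = (q.2, (-2 : ℝ) • G q)

/-- The part of `TM` where the coordinates lie in `Ω`. -/
def chartPreimage (z : TangentBundle (𝓡 n) M) (Ω : Set (Fibre n × Fibre n)) :
    Set (TangentBundle (𝓡 n) M) :=
  (chart z).source ∩ chart z ⁻¹' Ω

variable {z : TangentBundle (𝓡 n) M} {S : Field n M} {G : Fibre n × Fibre n → Fibre n}
  {Ω : Set (Fibre n × Fibre n)} {p : TangentBundle (𝓡 n) M}

lemma smoothAt_liouville (hp : p ∈ (chart z).source) : SmoothAt liouville p := by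
  refine (smoothAt_lift hp (Y := fun q => (0, q.2)) (contDiffAt_const.prodMk contDiffAt_snd)).congr
    (lift_eventuallyEq hp ?_)
  filter_upwards [chart_target_mem_nhds hp] with q hq
  have := hat_liouville ((chart z).map_target hq)
  rwa [(chart z).right_inv hq] at this

lemma hat_J_eventuallyEq (hp : p ∈ (chart z).source) (X : Field n M) :
    hat z (J X) =ᶠ[𝓝 (chart z p)] fun q => (0, (hat z X q).1) := by
  filter_upwards [chart_target_mem_nhds hp] with q hq
  have := hat_J ((chart z).map_target hq) X
  rwa [(chart z).right_inv hq] at this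

lemma smoothAt_J (hp : p ∈ (chart z).source) {X : Field n M} (hX : SmoothAt X p) :
    SmoothAt (J X) p :=
  smoothAt_of_hat hp ((contDiffAt_const.prodMk (hX.hat hp).fst).congr_of_eventuallyEq
    (hat_J_eventuallyEq hp X))

namespace IsLocalSpray

variable (h : IsLocalSpray z S G Ω)
include h

lemma isOpen_chartPreimage : IsOpen (chartPreimage z Ω) :=
  (continuousOn_extChartAt z).isOpen_inter_preimage (isOpen_chart_source z) h.isOpen

lemma chartPreimage_subset_slit : chartPreimage z Ω ⊆ slit n M := fun _ hp =>
  (mem_slit_iff hp.1).2 (h.ne_zero _ hp.2)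

lemma symm_mem {q : Fibre n × Fibre n} (hq : q ∈ Ω) :
    (chart z).symm q ∈ chartPreimage z Ω :=
  ⟨(chart z).map_target (h.subset hq), by
    rw [Set.mem_preimage, (chart z).right_inv (h.subset hq)]; exact hq⟩

variable (hp : p ∈ chartPreimage z Ω)
include hp

lemma eventually : ∀ᶠ r in 𝓝 p, r ∈ chartPreimage z Ω :=
  h.isOpen_chartPreimage.mem_nhds hp

lemma contDiffAt : ContDiffAt ℝ ∞ G (chart z p) :=
  h.smooth.contDiffAt (h.isOpen.mem_nhds hp.2)

lemma hat_eventuallyEq : hat z S =ᶠ[𝓝 (chart z p)] fun q => (q.2, (-2 : ℝ) • G q) :=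
  Filter.eventuallyEq_of_mem (h.isOpen.mem_nhds hp.2) h.hat_eq

lemma smoothAt : SmoothAt S p :=
  smoothAt_of_hat hp.1 ((contDiffAt_snd.prodMk ((h.contDiffAt hp).const_smul (-2 : ℝ)))
    |>.congr_of_eventuallyEq (h.hat_eventuallyEq hp))

/-- In coordinates `Γ` sends `(u, w)` to `(u, -2 N u - w)`; averaging with the identity removes `w`.
-/
lemma hat_hor {X : Field n M} (hX : SmoothAt X p) :
    hat z (hor S X) (chart z p) = Coord.horLift G (hat z X (chart z p)).1 (chart z p) := by
  have h1 := Coord.lieBracket_vert_sub ((h.contDiffAt hp).differentiableAt (by simp))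
    (h.hat_eventuallyEq hp) ((hX.hat hp.1).differentiableAt (by simp))
    (hat_J_eventuallyEq hp.1 X)
  rw [← hat_bracket hp.1 (smoothAt_J hp.1 hX) (h.smoothAt hp), ← hat_bracket hp.1 hX
    (h.smoothAt hp), ← hat_J hp.1, hat_chart hp.1, hat_chart hp.1] at h1
  rw [hat_chart hp.1, hor, map_smul, map_add, connection, map_sub, h1, ← hat_chart hp.1]
  ext1
  · simp [Coord.horLift, ← two_smul ℝ, smul_smul]
  · simp only [Coord.horLift, Prod.smul_snd, Prod.snd_add]
    module

lemma smoothAt_hor {X : Field n M} (hX : ∀ᶠ r in 𝓝 p, SmoothAt X r) : SmoothAt (hor S X) p := by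
  have hc := hX.self_of_nhds.hat hp.1
  have hs : ContDiffAt ℝ ∞ (fun q => Coord.horLift G (hat z X q).1 q) (chart z p) :=
    hc.fst.prodMk ((Coord.contDiffAt_fderiv (h.contDiffAt hp)).clm_apply
      (contDiffAt_const.prodMk hc.fst)).neg
  refine smoothAt_of_hat hp.1 (hs.congr_of_eventuallyEq ?_)
  filter_upwards [eventually_of_chart hp.1 (hX.and (h.eventually hp))] with q hq
  have := h.hat_hor hq.2.2 hq.2.1
  rwa [(chart z).right_inv hq.1] at this

lemma smoothAt_lift_horLift (u : Fibre n) : SmoothAt (lift z (Coord.horLift G u)) p :=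
  smoothAt_lift hp.1 (Coord.contDiffAt_horLift (h.contDiffAt hp) u)

omit hp in
lemma isHorizontalField (u : Fibre n) :
    IsHorizontalField S (lift z (Coord.horLift G u)) (chartPreimage z Ω) := by
  refine ⟨fun r hr => ContMDiffAt.contMDiffWithinAt (h.smoothAt_lift_horLift hr u),
    fun r hr => dchart_injective hr.1 ?_⟩
  rw [← hat_chart hr.1, ← hat_chart hr.1, h.hat_hor hr (h.smoothAt_lift_horLift hr u),
    hat_lift hr.1]
  rfl

lemma hat_lift_horLift_eventuallyEq (u : Fibre n) :
    hat z (lift z (Coord.horLift G u)) =ᶠ[𝓝 (chart z p)] Coord.horLift G u := by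
  filter_upwards [h.isOpen.mem_nhds hp.2] with q hq
  have := hat_lift (h.symm_mem hq).1 (Coord.horLift G u)
  rwa [(chart z).right_inv (h.subset hq)] at this

lemma hat_bracket_lift (u v : Fibre n) :
    hat z (bracket (lift z (Coord.horLift G u)) (lift z (Coord.horLift G v)))
      =ᶠ[𝓝 (chart z p)] lieBracket ℝ (Coord.horLift G u) (Coord.horLift G v) :=
  (hat_bracket_eventuallyEq hp.1
    ((h.eventually hp).mono fun _ hr => h.smoothAt_lift_horLift hr u)
    ((h.eventually hp).mono fun _ hr => h.smoothAt_lift_horLift hr v)).trans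
  ((h.hat_lift_horLift_eventuallyEq hp u).lieBracket_vectorField
    (h.hat_lift_horLift_eventuallyEq hp v))

lemma hat_bracket_bracket_lift (u v w : Fibre n) :
    hat z (bracket (lift z (Coord.horLift G w))
      (bracket (lift z (Coord.horLift G u)) (lift z (Coord.horLift G v)))) (chart z p)
      = lieBracket ℝ (Coord.horLift G w)
          (lieBracket ℝ (Coord.horLift G u) (Coord.horLift G v)) (chart z p) := by
  rw [hat_bracket hp.1 (h.smoothAt_lift_horLift hp w) (smoothAt_bracket hp.1
    ((h.eventually hp).mono fun _ hr => h.smoothAt_lift_horLift hr u)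
    ((h.eventually hp).mono fun _ hr => h.smoothAt_lift_horLift hr v))]
  exact (h.hat_lift_horLift_eventuallyEq hp w).lieBracket_vectorField_eq
    (h.hat_bracket_lift hp u v)

/-- Fullness of the holonomy distribution can be checked in coordinates. -/
lemma holonomyDistribution_eq_top
    (hK : ∀ K : Submodule ℝ (Fibre n × Fibre n),
      (∀ u, Coord.horLift G u (chart z p) ∈ K) →
      (∀ u v, lieBracket ℝ (Coord.horLift G u) (Coord.horLift G v) (chart z p) ∈ K) →
      (∀ u v w, lieBracket ℝ (Coord.horLift G w)
        (lieBracket ℝ (Coord.horLift G u) (Coord.horLift G v)) (chart z p) ∈ K) → K = ⊤) :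
    holonomyDistribution S p = ⊤ := by
  have hmem : ∀ X : Field n M, IsIteratedBracket S (chartPreimage z Ω) X →
      hat z X (chart z p) ∈ (holonomyDistribution S p).map (dchart z p : _ →ₗ[ℝ] _) :=
    fun X hX => ⟨X p, Submodule.subset_span
      ⟨_, X, h.isOpen_chartPreimage, hp, h.chartPreimage_subset_slit, hX, rfl⟩,
      (hat_chart hp.1 X).symm⟩
  have hb : ∀ u, IsIteratedBracket S (chartPreimage z Ω) (lift z (Coord.horLift G u)) :=
    fun u => .base _ (h.isHorizontalField u)
  -- The test subspace is the image of the distribution under the differential of the chart. Lifts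
  -- of constant vectors and their brackets with up to three entries suffice.
  have htop := hK ((holonomyDistribution S p).map (dchart z p : _ →ₗ[ℝ] _))
    (fun u => hat_lift hp.1 (Coord.horLift G u) ▸ hmem _ (hb u))
    (fun u v => (h.hat_bracket_lift hp u v).self_of_nhds ▸
      hmem _ (.step _ _ (h.isHorizontalField u) (hb v)))
    (fun u v w => h.hat_bracket_bracket_lift hp u v w ▸
      hmem _ (.step _ _ (h.isHorizontalField w) (.step _ _ (h.isHorizontalField u) (hb v))))
  rw [eq_top_iff]
  intro ξ _
  obtain ⟨η, hη, hηξ⟩ : dchart z p ξ ∈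
    (holonomyDistribution S p).map (dchart z p : _ →ₗ[ℝ] _) := by rw [htop]; trivial
  rwa [← dchart_injective hp.1 hηξ]

end IsLocalSpray

end LocalSpray

/-! ### Coordinate form of the spray axioms, homogeneity, invariance and nonlinearity. -/

section Reduction

open VectorField

/-- The coordinate expression of the homogeneity `[𝒞, S] = S`. -/
lemma Coord.euler_of_lieBracket {E : Type*} [NormedAddCommGroup E] [NormedSpace ℝ E]
    {G : E × E → E} {S C : E × E → E × E} {q : E × E} (hG : DifferentiableAt ℝ G q)
    (hS : S =ᶠ[𝓝 q] fun r => (r.2, (-2 : ℝ) • G r)) (hC : C =ᶠ[𝓝 q] fun r => (0, r.2))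
    (h : lieBracket ℝ C S q = S q) : fderiv ℝ G q (0, q.2) = (2 : ℝ) • G q := by
  have hSd : fderiv ℝ S q = _ := hS.fderiv_eq.trans
    (hasFDerivAt_snd.prodMk (hG.hasFDerivAt.const_smul (-2 : ℝ))).fderiv
  have hCd : fderiv ℝ C q = _ := hC.fderiv_eq.trans
    ((hasFDerivAt_const (0 : E) q).prodMk hasFDerivAt_snd).fderiv
  rw [lieBracket, hSd, hCd, hS.self_of_nhds, hC.self_of_nhds] at h
  have h2 : (-2 : ℝ) • fderiv ℝ G q (0, q.2) - (-2 : ℝ) • G q = (-2 : ℝ) • G q :=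
    congrArg Prod.snd h
  have h3 : (-2 : ℝ) • fderiv ℝ G q (0, q.2) = (-2 : ℝ) • ((2 : ℝ) • G q) := by
    rw [sub_eq_iff_eq_add.1 h2]
    module
  exact smul_right_injective E (by norm_num : (-2 : ℝ) ≠ 0) h3

variable {n : ℕ} {M : Type*} [TopologicalSpace M] [ChartedSpace (Fibre n) M]
  [IsManifold (𝓡 n) ∞ M]

/-- The coordinates of the nonzero tangent vectors. -/
def chartSlit (z : TangentBundle (𝓡 n) M) : Set (Fibre n × Fibre n) :=
  (chart z).target ∩ {q | q.2 ≠ 0}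

/-- The spray coefficients in the chart centred at `z`. -/
def sprayCoeff (z : TangentBundle (𝓡 n) M) (S : Field n M) (q : Fibre n × Fibre n) : Fibre n :=
  (-(1 / 2) : ℝ) • (hat z S q).2

variable (z : TangentBundle (𝓡 n) M)

lemma isOpen_chartSlit : IsOpen (chartSlit z) :=
  (isOpen_chart_target z).inter (isOpen_ne.preimage continuous_snd)

lemma mem_chartSlit_iff {p : TangentBundle (𝓡 n) M} (hp : p ∈ (chart z).source) :
    chart z p ∈ chartSlit z ↔ p ∈ slit n M := by
  rw [mem_slit_iff hp]
  exact and_iff_right ((chart z).map_source hp)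

variable {z}

lemma symm_mem_slit {q : Fibre n × Fibre n} (hq : q ∈ chartSlit z) :
    (chart z).symm q ∈ slit n M := by
  rw [← mem_chartSlit_iff z ((chart z).map_target hq.1), (chart z).right_inv hq.1]
  exact hq

lemma slit_mem_nhds {p : TangentBundle (𝓡 n) M} (hp : p ∈ slit n M) : slit n M ∈ 𝓝 p := by
  have hs : p ∈ (chart p).source := mem_extChartAt_source p
  filter_upwards [eventually_chart hs ((isOpen_chartSlit p).mem_nhds
    ((mem_chartSlit_iff p hs).2 hp))] with r hr
  exact (mem_chartSlit_iff p hr.1).1 hr.2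

lemma contDiffOn_comp_chart_symm {P : TangentBundle (𝓡 n) M → ℝ}
    (hP : ContMDiffOn (modelTM n) 𝓘(ℝ, ℝ) ∞ P (slit n M)) :
    ContDiffOn ℝ ∞ (P ∘ (chart z).symm) (chartSlit z) := by
  rw [← contMDiffOn_iff_contDiffOn]
  exact hP.comp ((contMDiffOn_extChartAt_symm z).mono Set.inter_subset_left)
    fun q hq => symm_mem_slit hq

section Spray

variable {S : Field n M} (hS : IsSpray S)
include hS

/-- The condition `J S = 𝒞` forces the first component to be `y`; the second one then defines `G`.
-/
lemma IsSpray.isLocalSpray (z : TangentBundle (𝓡 n) M) :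
    IsLocalSpray z S (sprayCoeff z S) (chartSlit z) where
  isOpen := isOpen_chartSlit z
  subset := Set.inter_subset_left
  ne_zero := fun _ hq => hq.2
  smooth := fun q hq => by
    have hr := (chart z).map_target hq.1
    have := SmoothAt.hat hr (hS.smooth.smoothAt (slit_mem_nhds (symm_mem_slit hq)))
    rw [(chart z).right_inv hq.1] at this
    exact (this.snd.const_smul (-(1 / 2) : ℝ)).contDiffWithinAt
  hat_eq := fun q hq => by
    have hr := (chart z).map_target hq.1
    have h1 := congrArg (dchart z ((chart z).symm q)) (hS.J_eq _ (symm_mem_slit hq))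
    rw [← hat_chart hr, ← hat_chart hr, hat_J hr, hat_liouville hr, (chart z).right_inv hq.1] at h1
    ext1
    · exact congrArg Prod.snd h1
    · simp [sprayCoeff, smul_smul]

lemma IsSpray.euler {q : Fibre n × Fibre n} (hq : q ∈ chartSlit z) :
    fderiv ℝ (sprayCoeff z S) q (0, q.2) = (2 : ℝ) • sprayCoeff z S q := by
  have h := hS.isLocalSpray z
  have hr := h.symm_mem hq
  have hG := h.contDiffAt hr
  have he := h.hat_eventuallyEq hr
  have hb := hat_bracket hr.1 (smoothAt_liouville hr.1) (h.smoothAt hr)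
  rw [hat_chart hr.1, hS.homogeneous _ (symm_mem_slit hq), ← hat_chart hr.1] at hb
  rw [(chart z).right_inv hq.1] at hG he hb
  refine Coord.euler_of_lieBracket (hG.differentiableAt (by simp)) he ?_ hb.symm
  filter_upwards [(isOpen_chart_target z).mem_nhds hq.1] with r hr
  have := hat_liouville ((chart z).map_target hr)
  rwa [(chart z).right_inv hr] at this

lemma isLocalSpray_projectiveDeformation (P : TangentBundle (𝓡 n) M → ℝ)
    (hP : ContMDiffOn (modelTM n) 𝓘(ℝ, ℝ) ∞ P (slit n M)) (c : ℝ) :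
    IsLocalSpray z (projectiveDeformation S (fun p => c * P p))
      (Coord.deform c (P ∘ (chart z).symm) (sprayCoeff z S)) (chartSlit z) where
  isOpen := isOpen_chartSlit z
  subset := Set.inter_subset_left
  ne_zero := fun _ hq => hq.2
  smooth := (hS.isLocalSpray z).smooth.add
    ((contDiffOn_const.mul (contDiffOn_comp_chart_symm hP)).smul contDiffOn_snd)
  hat_eq := fun q hq => by
    have hr := (chart z).map_target hq.1
    have h1 := hat_chart hr (projectiveDeformation S (fun p => c * P p))
    rw [projectiveDeformation, map_sub, map_smul, ← hat_chart hr, ← hat_chart hr,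
      hat_liouville hr, (chart z).right_inv hq.1, (hS.isLocalSpray z).hat_eq q hq] at h1
    refine h1.trans ?_
    ext1
    · simp
    · simp only [Coord.deform, Function.comp_apply, Prod.snd_sub, Prod.smul_snd]
      module

end Spray

section Function

variable {P : TangentBundle (𝓡 n) M → ℝ}

lemma chart_symm_smul {p : TangentBundle (𝓡 n) M} (hp : p ∈ (chart z).source) (t : ℝ) :
    (chart z).symm ((chart z p).1, t • (chart z p).2) = ⟨p.1, t • p.2⟩ := by
  have hp' : (⟨p.1, t • p.2⟩ : TangentBundle (𝓡 n) M) ∈ (chart z).source := by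
    rw [mem_chart_source] at hp ⊢
    exact hp
  rw [← (chart z).left_inv hp', chart_apply z hp, chart_apply z hp']
  congr 2
  exact (map_smul _ _ _).symm

lemma IsOneHomogeneous.euler (hP : IsOneHomogeneous P)
    (hPs : ContMDiffOn (modelTM n) 𝓘(ℝ, ℝ) ∞ P (slit n M)) {q : Fibre n × Fibre n}
    (hq : q ∈ chartSlit z) :
    fderiv ℝ (P ∘ (chart z).symm) q (0, q.2) = (P ∘ (chart z).symm) q := by
  set f := P ∘ (chart z).symm with hf
  have hr := (chart z).map_target hq.1
  have hd : HasFDerivAt f (fderiv ℝ f q) (q.1, (1 : ℝ) • q.2) := by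
    rw [one_smul]
    exact (((contDiffOn_comp_chart_symm hPs).contDiffAt ((isOpen_chartSlit z).mem_nhds
      hq)).differentiableAt (by simp)).hasFDerivAt
  have h1 : HasDerivAt (fun t : ℝ => f (q.1, t • q.2)) (fderiv ℝ f q (0, q.2)) 1 := by
    have := (hasDerivAt_const (1 : ℝ) q.1).prodMk ((hasDerivAt_id (1 : ℝ)).smul_const q.2)
    simpa using! hd.comp_hasDerivAt (1 : ℝ) this
  have h2 : HasDerivAt (fun t : ℝ => f (q.1, t • q.2)) (f q) 1 := by
    have h3 : HasDerivAt (fun t : ℝ => t * f q) (f q) 1 := by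
      simpa using (hasDerivAt_id (1 : ℝ)).mul_const (f q)
    refine h3.congr_of_eventuallyEq ?_
    -- Homogeneity holds for `t > 0` only, which is enough for the derivative at `t = 1`.
    filter_upwards [lt_mem_nhds one_pos] with t ht
    have := chart_symm_smul hr t
    rw [(chart z).right_inv hq.1] at this
    simp only [hf, Function.comp_apply, this]
    exact hP _ (symm_mem_slit hq) t ht
  exact h1.unique h2

/-- An integral curve of the lift of `u` through `q` is a parallel field, so `P` is constant along
it; the derivative at time `0` is the claim. -/
lemma IsHolonomyInvariant.fderiv_horLift {S : Field n M} {G : Fibre n × Fibre n → Fibre n}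
    {Ω : Set (Fibre n × Fibre n)} (h : IsLocalSpray z S G Ω) (hP : IsHolonomyInvariant S P)
    (u : Fibre n) {q : Fibre n × Fibre n} (hq : q ∈ Ω)
    (hd : DifferentiableAt ℝ (P ∘ (chart z).symm) q) :
    fderiv ℝ (P ∘ (chart z).symm) q (Coord.horLift G u q) = 0 := by
  have hG : ContDiffAt ℝ ∞ G q := h.smooth.contDiffAt (h.isOpen.mem_nhds hq)
  obtain ⟨α, hα0, ε, hε, hα⟩ :=
    ((Coord.contDiffAt_horLift hG u).of_le
      (by exact_mod_cast le_top)).exists_forall_mem_closedBall_exists_eq_forall_mem_Ioo_hasDerivAt₀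
      (0 : ℝ)
  have hev : ∀ᶠ t in 𝓝 (0 : ℝ), α t ∈ Ω ∧ HasDerivAt α (Coord.horLift G u (α t)) t := by
    have hc : ContinuousAt α 0 := (hα 0 (by simp [hε])).continuousAt
    refine (hc.eventually (h.isOpen.mem_nhds (by rwa [hα0]))).and ?_
    filter_upwards [Ioo_mem_nhds (by linarith : (0 : ℝ) - ε < 0) (by linarith : 0 < 0 + ε)] with t ht
    exact hα t ht
  obtain ⟨δ, hδ, hδα⟩ := Metric.eventually_nhds_iff.1 hev
  have hpar : ∀ a b : ℝ, |a| < δ → |b| < δ →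
      IsParallelOn S (fun t => (chart z).symm (α t)) a b := by
    intro a b ha hb t ht
    have htδ : dist t 0 < δ := by
      rw [Real.dist_eq, sub_zero, abs_lt]
      exact ⟨(abs_lt.1 ha).1.trans_le ht.1, ht.2.trans_lt (abs_lt.1 hb).2⟩
    obtain ⟨htΩ, htd⟩ := hδα htδ
    have hm := h.symm_mem htΩ
    have hsymm : MDifferentiableAt 𝓘(ℝ, Fibre n × Fibre n) (modelTM n) (chart z).symm (α t) :=
      ((contMDiffOn_extChartAt_symm z).contMDiffAt
        ((isOpen_chart_target z).mem_nhds (h.subset htΩ))).mdifferentiableAt (n := ∞) (by simp)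
    have hγ : MDifferentiableAt 𝓘(ℝ, ℝ) (modelTM n) (fun t => (chart z).symm (α t)) t :=
      hsymm.comp t htd.differentiableAt.mdifferentiableAt
    refine ⟨h.chartPreimage_subset_slit hm, hγ, _, lift z (Coord.horLift G u),
      h.isOpen_chartPreimage, hm, h.chartPreimage_subset_slit, h.isHorizontalField u, ?_⟩
    apply dchart_injective hm.1
    rw [dchart_lift hm.1, (chart z).right_inv (h.subset htΩ)]
    have h1 : mfderiv 𝓘(ℝ, ℝ) 𝓘(ℝ, Fibre n × Fibre n)
        (chart z ∘ fun t => (chart z).symm (α t)) t = _ :=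
      mfderiv_comp t ((contMDiffAt_chart hm.1).mdifferentiableAt (by simp)) hγ
    have h2 : (chart z ∘ fun t => (chart z).symm (α t)) =ᶠ[𝓝 t] α := by
      filter_upwards [htd.continuousAt.eventually (h.isOpen.mem_nhds htΩ)] with s hs
      exact (chart z).right_inv (h.subset hs)
    have h3 : mfderiv 𝓘(ℝ, ℝ) 𝓘(ℝ, Fibre n × Fibre n) α t = fderiv ℝ α t := mfderiv_eq_fderiv
    rw [h2.mfderiv_eq, h3, htd.hasFDerivAt.fderiv] at h1
    have h4 := congrArg (fun L => L (1 : ℝ)) h1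
    exact (one_smul ℝ _).symm.trans h4
  have hconst : (P ∘ (chart z).symm) ∘ α =ᶠ[𝓝 0] fun _ => P ((chart z).symm q) := by
    filter_upwards [Metric.ball_mem_nhds (0 : ℝ) hδ] with t ht
    have ht' : |t| < δ := by simpa using ht
    have h0 : |(0 : ℝ)| < δ := by simpa using hδ
    rw [← hα0]
    -- Invariance is stated for `a ≤ b`, so negative times use the curve from `t` to `0`.
    rcases le_total 0 t with h0t | h0t
    · exact hP _ 0 t h0t (hpar 0 t h0 ht')
    · exact (hP _ t 0 h0t (hpar t 0 ht' h0)).symm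
  have h1 : HasDerivAt ((P ∘ (chart z).symm) ∘ α)
      (fderiv ℝ (P ∘ (chart z).symm) q (Coord.horLift G u q)) 0 := by
    have h2 : HasFDerivAt (P ∘ (chart z).symm) (fderiv ℝ (P ∘ (chart z).symm) q) (α 0) := by
      rw [hα0]
      exact hd.hasFDerivAt
    have h3 := h2.comp_hasDerivAt (0 : ℝ) (hα 0 (by simp [hε]))
    rwa [hα0] at h3
  exact h1.unique ((hasDerivAt_const (0 : ℝ) _).congr_of_eventuallyEq hconst)

/-- The chart of `M` has identity differential at its own centre, so the fibre coordinates over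
`z.1` are the ones in which `fibreHessian` is computed. -/
lemma chart_symm_fibre (z : TangentBundle (𝓡 n) M) (y : Fibre n) :
    (chart z).symm (extChartAt (𝓡 n) z.1 z.1, y) = ⟨z.1, y⟩ := by
  have hp : (⟨z.1, y⟩ : TangentBundle (𝓡 n) M) ∈ (chart z).source := by simp
  rw [← (chart z).left_inv hp, chart_apply z hp, mfderiv_extChartAt_self]
  rfl

lemma IsNonlinearAt.exists_ne_zero (hP : IsNonlinearAt P z) (hz : z ∈ slit n M)
    (hPs : ContMDiffOn (modelTM n) 𝓘(ℝ, ℝ) ∞ P (slit n M)) :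
    ∃ a w : Fibre n,
      fderiv ℝ (fderiv ℝ (P ∘ (chart z).symm)) (chart z z) (0, a) (0, w) ≠ 0 := by
  set f := P ∘ (chart z).symm with hf
  by_contra! hcon
  refine hP ?_
  have hsm : ∀ q ∈ chartSlit z, ContDiffAt ℝ ∞ f q := fun q hq =>
    (contDiffOn_comp_chart_symm hPs).contDiffAt ((isOpen_chartSlit z).mem_nhds hq)
  have hzs : chart z z ∈ chartSlit z := (mem_chartSlit_iff z (mem_extChartAt_source z)).2 hz
  have hι : ∀ y : Fibre n, HasFDerivAt (fun y : Fibre n => (extChartAt (𝓡 n) z.1 z.1, y))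
      (ContinuousLinearMap.inr ℝ (Fibre n) (Fibre n)) y := fun y => hasFDerivAt_prodMk_right _ y
  let y₀ : Fibre n := z.2
  have hy₀ : chart z z = (extChartAt (𝓡 n) z.1 z.1, y₀) := chart_self z
  rw [hy₀] at hcon hzs
  have hfib : (fun y : Fibre n => P ⟨z.1, y⟩) = fun y => f (extChartAt (𝓡 n) z.1 z.1, y) :=
    funext fun y => by simp only [hf, Function.comp_apply, chart_symm_fibre]
  let Λ := (ContinuousLinearMap.compL ℝ (Fibre n) (Fibre n × Fibre n) ℝ).flip
    (ContinuousLinearMap.inr ℝ (Fibre n) (Fibre n))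
  have hev : fderiv ℝ (fun y => f (extChartAt (𝓡 n) z.1 z.1, y)) =ᶠ[𝓝 y₀]
      fun y => Λ (fderiv ℝ f (extChartAt (𝓡 n) z.1 z.1, y)) := by
    filter_upwards [(hι y₀).continuousAt.eventually ((isOpen_chartSlit z).mem_nhds hzs)] with y hy
    exact (((hsm _ hy).differentiableAt (by simp)).hasFDerivAt.comp y (hι y)).fderiv
  have h2 : HasFDerivAt (fun y => Λ (fderiv ℝ f (extChartAt (𝓡 n) z.1 z.1, y))) _ y₀ :=
    Λ.hasFDerivAt.comp y₀ ((((Coord.contDiffAt_fderiv (hsm _ hzs)).differentiableAt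
      (by simp)).hasFDerivAt).comp y₀ (hι y₀))
  rw [fibreHessian, hfib]
  change fderiv ℝ (fderiv ℝ (fun y => f (extChartAt (𝓡 n) z.1 z.1, y))) y₀ = 0
  rw [hev.fderiv_eq, h2.fderiv]
  ext a w
  exact hcon a w

end Function

/-! ### The Jacobi endomorphism in coordinates. -/

section Jacobi

variable {S : Field n M}

lemma bracket_congr {p : TangentBundle (𝓡 n) M} {X X' Y Y' : Field n M} (hX : X =ᶠ[𝓝 p] X')
    (hY : Y =ᶠ[𝓝 p] Y') : bracket X Y =ᶠ[𝓝 p] bracket X' Y' :=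
  hX.mlieBracket_vectorField hY

lemma J_congr {p : TangentBundle (𝓡 n) M} {X Y : Field n M} (h : X p = Y p) : J X p = J Y p := by
  simp only [J, h]

lemma hor_congr {p : TangentBundle (𝓡 n) M} {X Y : Field n M} (h : X =ᶠ[𝓝 p] Y) :
    hor S X p = hor S Y p := by
  have h1 : J X =ᶠ[𝓝 p] J Y := h.mono fun r hr => J_congr hr
  simp only [hor, connection, h.self_of_nhds, (bracket_congr h1 (.refl _ S)).self_of_nhds,
    J_congr (bracket_congr h (.refl _ S)).self_of_nhds]

/-- The Jacobi endomorphism is the vertical part of `[S, X]` for a horizontal field `X`. -/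
lemma jacobi_eq {p : TangentBundle (𝓡 n) M} {X : Field n M} (hS : hor S S =ᶠ[𝓝 p] S)
    (hX : hor S X =ᶠ[𝓝 p] X) :
    jacobi S X p = bracket S X p + hor S (hor S (bracket S X)) p - hor S (bracket S X) p
      - hor S (bracket S X) p := by
  simp only [jacobi, curvature]
  rw [(bracket_congr hS hX).self_of_nhds, hor_congr (bracket_congr hS (.refl _ X)),
    hor_congr (bracket_congr (.refl _ S) hX)]

/-- Since `S` and the lift are horizontal, `Φ` is `[S, X] - h [S, X]`; `lieBracket_spray` then
replaces `S` by the lift of the frozen vector `y`. -/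
lemma IsSpray.hat_jacobi (hS : IsSpray S) {f : Fibre n × Fibre n → ℝ}
    (hI : Coord.Invariant (sprayCoeff z S) f (chartSlit z)) {p : TangentBundle (𝓡 n) M}
    (hp : p ∈ chartPreimage z (chartSlit z)) (v : Fibre n) :
    hat z (jacobi S (lift z (Coord.horLift (sprayCoeff z S) v))) (chart z p)
      = (0, (lieBracket ℝ (Coord.horLift (sprayCoeff z S) (chart z p).2)
          (Coord.horLift (sprayCoeff z S) v) (chart z p)).2) := by
  have h := hS.isLocalSpray z
  set G := sprayCoeff z S
  set X := lift z (Coord.horLift G v)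
  have hSS : hor S S =ᶠ[𝓝 p] S := by
    filter_upwards [h.eventually hp] with r hr
    apply dchart_injective hr.1
    rw [← hat_chart hr.1, ← hat_chart hr.1, h.hat_hor hr (h.smoothAt hr), h.hat_eq _ hr.2]
    simpa [Coord.horLift, Coord.nonlin_apply, G] using hS.euler hr.2
  have hXX : hor S X =ᶠ[𝓝 p] X := by
    filter_upwards [h.eventually hp] with r hr
    exact (h.isHorizontalField v).2 r hr
  have hB : ∀ᶠ r in 𝓝 p, SmoothAt (bracket S X) r := by
    filter_upwards [h.eventually hp] with r hr
    exact smoothAt_bracket hr.1 ((h.eventually hr).mono fun _ => h.smoothAt)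
      ((h.eventually hr).mono fun _ ht => h.smoothAt_lift_horLift ht v)
  have hbr : hat z (bracket S X) (chart z p)
      = lieBracket ℝ (hat z S) (Coord.horLift G v) (chart z p) := by
    rw [hat_bracket hp.1 (h.smoothAt hp) (h.smoothAt_lift_horLift hp v)]
    exact Filter.EventuallyEq.lieBracket_vectorField_eq .rfl (h.hat_lift_horLift_eventuallyEq hp v)
  rw [hat_chart hp.1, jacobi_eq hSS hXX, map_sub, map_sub, map_add, ← hat_chart hp.1,
    ← hat_chart hp.1, ← hat_chart hp.1, h.hat_hor hp (h.smoothAt_hor hp hB),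
    h.hat_hor hp hB.self_of_nhds, hbr, ← hI.lieBracket_spray hp.2 v h.hat_eq]
  ext1
  · simp [Coord.horLift]
  · simp only [Coord.horLift, Prod.snd_add, Prod.snd_sub]
    module

end Jacobi

end Reduction

end

end FinslerSpray

theorem mainTheorem3 {n : ℕ} {M : Type*} [TopologicalSpace M] [T2Space M]
    [ChartedSpace (EuclideanSpace ℝ (Fin n)) M] [IsManifold (𝓡 n) ∞ M]
    (S : FinslerSpray.Field n M) (hS : FinslerSpray.IsFinslerMetrizable S)
    (P : TangentBundle (𝓡 n) M → ℝ)
    (hPsmooth : ContMDiffOn (𝓡 n).tangent 𝓘(ℝ, ℝ) ∞ P (FinslerSpray.slit n M))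
    (hPhom : FinslerSpray.IsOneHomogeneous P)
    (hPinv : FinslerSpray.IsHolonomyInvariant S P)
    (lam : ℝ) (z : TangentBundle (𝓡 n) M) (hz : z ∈ FinslerSpray.slit n M)
    (hlam : ∀ κ : ℝ, FinslerSpray.IsJacobiEigenvalue S z κ → κ + lam ^ 2 * P z ^ 2 ≠ 0)
    (hPnonlin : FinslerSpray.IsNonlinearAt P z) :
    FinslerSpray.holonomyDistribution
      (FinslerSpray.projectiveDeformation S (fun p => lam * P p)) z = ⊤ := by
  open FinslerSpray in
  obtain ⟨F, -, hS, -⟩ := hS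
  have h := hS.isLocalSpray z
  have hI : Coord.Invariant (sprayCoeff z S) (P ∘ (chart z).symm) (chartSlit z) :=
    { isOpen := isOpen_chartSlit z
      smoothG := h.smooth
      smooth := contDiffOn_comp_chart_symm hPsmooth
      homG := fun q hq => hS.euler hq
      hom := fun q hq => hPhom.euler hPsmooth hq
      invariant := fun u q hq => hPinv.fderiv_horLift h u hq
        (((contDiffOn_comp_chart_symm hPsmooth).contDiffAt
          ((isOpen_chartSlit z).mem_nhds hq)).differentiableAt (by simp)) }
  have hzs : z ∈ (chart z).source := mem_extChartAt_source z
  have hzm : z ∈ chartPreimage z (chartSlit z) := ⟨hzs, (mem_chartSlit_iff z hzs).2 hz⟩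
  have hPz : (P ∘ (chart z).symm) (chart z z) = P z := by
    rw [Function.comp_apply, (chart z).left_inv hzs]
  refine (isLocalSpray_projectiveDeformation hS P hPsmooth lam).holonomyDistribution_eq_top hzm
    fun K h1 h2 h3 => hI.eq_top_of_mem hzm.2 lam ?_ hzm.2.2
      (hPnonlin.exists_ne_zero hz hPsmooth) h1 h2 h3
  intro κ v hv hκ
  rw [hPz]
  -- A coordinate eigenvector `v` becomes an eigenvector of `Φ` through its horizontal lift, whose
  -- first component `v` keeps it nonzero at `z`.
  refine hlam κ ⟨_, lift z (Coord.horLift (sprayCoeff z S) v), h.isOpen_chartPreimage, hzm,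
    h.chartPreimage_subset_slit, h.isHorizontalField v, fun h0 => hv ?_, ?_⟩
  · have h4 := hat_lift hzs (Coord.horLift (sprayCoeff z S) v)
    rw [hat_chart hzs, h0, map_zero] at h4
    exact (congrArg Prod.fst h4).symm
  · apply dchart_injective hzs
    rw [← hat_chart hzs, hS.hat_jacobi hI hzm v, hκ, map_smul, dchart_J hzs, dchart_lift hzs]
    simp [Coord.horLift]
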